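/- Let $\varphi:[0,2\pi]\to\mathbb R$ be continuous, strictly increasing and strictly concave, with $\varphi(0)=0$ and $\varphi(2\pi)=1$. For a measurable function $x:[0,2\pi]\to\mathbb C$ put $$\|x\|_{\Lambda(\varphi)}=\int_0^{2\pi}x^*(t)\,d\varphi(t),\qquad x^*(t)=\inf\{\tau\ge 0:\ m\{s\in[0,2\pi]:|x(s)|>\tau\}\le t\},$$ where $m$ is Lebesgue measure. Let $H(\Lambda(\varphi))$ be the space of all analytic functions $f$ on the unit disc $\mathbb D$ such that $\|f\|_{H(\Lambda(\varphi))}:=\sup_{0\le r<1}\|f_r\|_{\Lambda(\varphi)}<\infty$, where $f_r(t)=f(re^{it})$, and let $f(e^{it})$ denote the nontangential limit of $f$ at $e^{it}$, which exists for almost all $t\in[0,2\pi]$. (1) If $f\in H(\Lambda(\varphi))$, $\|f\|_{H(\Lambda(\varphi))}=1$, and $|f(e^{it})|$ is constant on some subset of $[0,2\pi]$ of positive measure, then $f$ is an extreme point of the closed unit ball of $H(\Lambda(\varphi))$. (2) A function $f$ as in (1) need be neither inner nor outer: for every such $\varphi$ there is an $f\in H(\Lambda(\varphi))$ with $\|f\|_{H(\Lambda(\varphi))}=1$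 such that $|f(e^{it})|$ is constant on some subset of $[0,2\pi]$ of positive measure and $f$ is neither inner nor outer. Here $f$ is inner if it is analytic and bounded on $\mathbb D$ with $|f(e^{it})|=1$ for almost all $t$; and a function $f\not\equiv 0$ in the Hardy space $H^1$ is outer if $\ln|f(0)|=\frac1{2\pi}\int_0^{2\pi}\ln|f(e^{it})|\,dt$. -/

import Mathlib

open Set MeasureTheory Filter
open scoped ENNReal NNReal Topology

noncomputable section

namespace HardyLorentz

/-- A weight `φ` on `[0, a]`: an increasing, concave, continuous real function on `[0, a]` with
`φ 0 = 0` and `φ a = 1`. Values of `φ` outside `[0, a]` are never used. -/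
structure LorentzWeight (a : ℝ) where
  toFun : ℝ → ℝ
  pos : 0 < a
  monotoneOn : MonotoneOn toFun (Icc 0 a)
  concaveOn : ConcaveOn ℝ (Icc 0 a) toFun
  continuousOn : ContinuousOn toFun (Icc 0 a)
  map_zero : toFun 0 = 0
  map_right : toFun a = 1

namespace LorentzWeight

variable {a : ℝ}

instance : CoeFun (LorentzWeight a) (fun _ => ℝ → ℝ) := ⟨LorentzWeight.toFun⟩

/-- The Stieltjes function of `φ`, extended to `ℝ` by the constants `φ 0` and `φ a`. -/
def stieltjes (φ : LorentzWeight a) : StieltjesFunction ℝ where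
  toFun t := φ (projIcc 0 a φ.pos.le t)
  mono' _ _ h := φ.monotoneOn (projIcc 0 a φ.pos.le _).2 (projIcc 0 a φ.pos.le _).2
    (monotone_projIcc φ.pos.le h)
  right_continuous' _ :=
    (φ.continuousOn.comp_continuous (continuous_subtype_val.comp continuous_projIcc)
      (fun s => (projIcc 0 a φ.pos.le s).2)).continuousWithinAt

end LorentzWeight

/-- The decreasing rearrangement
`x*(t) = inf {τ ≥ 0 : m {s ∈ [0, a] : |x s| > τ} ≤ t}` of `|x|`, for `x : [0, a] → ℂ`. -/
def rearrangement (a : ℝ) (x : ℝ → ℂ) (t : ℝ) : ℝ≥0∞ :=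
  ⨅ (τ : ℝ≥0) (_ : volume {s | s ∈ Icc 0 a ∧ τ < ‖x s‖₊} ≤ ENNReal.ofReal t), (τ : ℝ≥0∞)

/-- The Lorentz norm `‖x‖ = ∫₀ᵃ x*(t) dφ(t)`, a Lebesgue–Stieltjes integral
(with value `∞` when `x` is a measurable function outside `Λ(φ)`). -/
def lorentzNorm {a : ℝ} (φ : LorentzWeight a) (x : ℝ → ℂ) : ℝ≥0∞ :=
  ∫⁻ t in Ioc 0 a, rearrangement a x t ∂φ.stieltjes.measure

/-- The open unit disc `𝔻` of `ℂ`. -/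
abbrev Disc : Type := Metric.ball (0 : ℂ) 1

/-- The extension of a function on `𝔻` to `ℂ` by zero. -/
def extend (f : Disc → ℂ) (z : ℂ) : ℂ :=
  open Classical in if h : z ∈ Metric.ball (0 : ℂ) 1 then f ⟨z, h⟩ else 0

/-- `f` is analytic (holomorphic) in `𝔻`. -/
def IsAnalytic (f : Disc → ℂ) : Prop :=
  DifferentiableOn ℂ (extend f) (Metric.ball (0 : ℂ) 1)

/-- The function `f_r`, `t ↦ f (r e^{it})`, used for `0 ≤ r < 1`. -/
def slice (f : Disc → ℂ) (r : ℝ) (t : ℝ) : ℂ :=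
  extend f (r * Complex.exp (t * Complex.I))

/-- `sup_{0 ≤ r < 1} ‖f_r‖_X`, where `N` is the norm of the space `X` on `[0, 2π]`. -/
def hardyNorm (N : (ℝ → ℂ) → ℝ≥0∞) (f : Disc → ℂ) : ℝ≥0∞ :=
  ⨆ r ∈ Ico (0 : ℝ) 1, N (slice f r)

/-- `f` belongs to the Hardy-type space `H(X)`, where `N` is the norm of `X` on `[0, 2π]`. -/
def MemHardy (N : (ℝ → ℂ) → ℝ≥0∞) (f : Disc → ℂ) : Prop :=
  IsAnalytic f ∧ hardyNorm N f < ∞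

/-- The closed unit ball of `H(X)`. -/
def hardyUnitBall (N : (ℝ → ℂ) → ℝ≥0∞) : Set (Disc → ℂ) :=
  {f | MemHardy N f ∧ hardyNorm N f ≤ 1}

/-- The norm of `L^p[0, 2π]`. -/
def circleLpNorm (p : ℝ≥0∞) (x : ℝ → ℂ) : ℝ≥0∞ :=
  eLpNorm x p (volume.restrict (Icc 0 (2 * Real.pi)))

/-- `w` is the nontangential limit of `f` at the boundary point `e^{it}`: the limit of `f z` as
`z → e^{it}` inside each Stolz region `|z - e^{it}| < M (1 - |z|)`. -/
def HasNontangentialLimit (f : Disc → ℂ) (t : ℝ) (w : ℂ) : Prop :=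
  ∀ M : ℝ, Tendsto (extend f)
    (𝓝[{z : ℂ | ‖z‖ < 1 ∧ ‖z - Complex.exp (t * Complex.I)‖ < M * (1 - ‖z‖)}]
      (Complex.exp (t * Complex.I))) (𝓝 w)

/-- The modulus `|f(e^{it})|` of the nontangential limit of `f` is constant on some measurable
subset of `[0, 2π]` of positive measure. -/
def HasConstantModulusOnPositiveSet (f : Disc → ℂ) : Prop :=
  ∃ c : ℝ, ∃ E : Set ℝ, E ⊆ Icc 0 (2 * Real.pi) ∧ MeasurableSet E ∧ 0 < volume E ∧
    ∀ t ∈ E, ∃ w : ℂ, HasNontangentialLimit f t w ∧ ‖w‖ = c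

/-- Inner functions: `f ∈ H^∞` and `|f(e^{it})| = 1` for almost all `t ∈ [0, 2π]`. -/
def IsInner (f : Disc → ℂ) : Prop :=
  MemHardy (circleLpNorm ∞) f ∧
    ∀ᵐ t ∂(volume.restrict (Icc 0 (2 * Real.pi))),
      ∃ w : ℂ, HasNontangentialLimit f t w ∧ ‖w‖ = 1

/-- Outer functions: non-null `f ∈ H^1` with
`ln |f 0| = (1 / 2π) ∫₀^{2π} ln |f(e^{it})| dt`. The function `u` is `t ↦ f(e^{it})`.
As the integral is finite, the equality includes `f 0 ≠ 0`, which is written out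
because `Real.log 0 = 0`. -/
def IsOuter (f : Disc → ℂ) : Prop :=
  MemHardy (circleLpNorm 1) f ∧ extend f 0 ≠ 0 ∧
    ∃ u : ℝ → ℂ,
      (∀ᵐ t ∂(volume.restrict (Icc 0 (2 * Real.pi))), HasNontangentialLimit f t (u t)) ∧
      IntegrableOn (fun t => Real.log ‖u t‖) (Icc 0 (2 * Real.pi)) volume ∧
      Real.log ‖extend f 0‖ =
        (1 / (2 * Real.pi)) * ∫ t in Icc 0 (2 * Real.pi), Real.log ‖u t‖

end HardyLorentz

end

/-!
The proof of the first part transfers the problem to the boundary of the disc, where convexity of the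
Lorentz norm decides it, and returns to the disc by a uniqueness theorem.

*Lorentz norm.* By the layer cake formula, `‖x‖_Λ(φ) = ∫₀^∞ φ (m {|x| > τ}) dτ`
(`lorentzNorm_eq_choquet`), a Choquet integral. A concave weight is a mixture of the functions
`t ↦ min t σ`, and so the norm is a mixture of the K-functionals
`∫₀^∞ min (m {|x| > τ}) σ dτ = inf_{l ≥ 0} (σ l + ∫ (|x| - l)⁺)` (`LorentzWeight.exists_choquet_eq`).
The triangle inequality, the Fatou property and the monotonicity of the means over circles are evident
for the K-functionals, the last by subharmonicity of `(|g| - l)⁺`, and are inherited by the norm. The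
norm is strictly monotone if `φ` is strictly increasing (`ae_eq_of_le_of_choquet_le`). If `φ` is
strictly concave, replacing a function on a set `S` by its mean over `S` strictly diminishes the norm,
unless the function is constant on `S` (`ae_eq_average_of_choquet_le`).

*Boundary functions.* The Lorentz norm dominates the `L¹` norm, so the functions of the space belong
to `H¹`. An `H¹` function `g` is a product of two `H²` functions: Taylor polynomials of dilations of `g`
factor explicitly through their roots, with bounds in `H²`, and the Taylor coefficients of the factors
have limits along an ultrafilter (`exists_sq_summable_factorization`). By Parseval's identity it
follows that `t ↦ g (r e^{it})` converges in `L¹` (`exists_boundary_function`). The norm of `f` is the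
Lorentz norm of this boundary function (`choquet_boundaryFunction`), which equals the nontangential
limit where that exists. By Jensen's formula the boundary function of a function other than zero cannot
vanish on a set of positive measure (`eq_zero_of_tendsto_setIntegral_zero`).

*Extreme points.* Let `f = a g + b h` be a proper convex combination in the unit ball, with `‖f‖ = 1`
and `|f|` constant on `S`. On the boundary `|f| ≤ a |g| + b |h|`, and as the right side has norm at most
`1`, strict monotonicity gives equality almost everywhere. Averaging `|g|` and `|h|` over `S` keeps the
domination of `|f|`, so the average of `|g|` still has norm `1`, and `|g|` is constant on `S`
(`ae_eq_of_le_convex_combination`). Equality in the triangle inequality makes `g` a nonnegative multiple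
`λ f` on `S`, with `λ` constant since both moduli are. By uniqueness `g = λ f` in the disc, and the
norms give `λ = 1`.

*Example.* The function `z exp (-i log ((1 + z) / (1 - z)))` has a boundary modulus that takes one
constant value on each of the two half-circles, so that no multiple of it is inner, and it vanishes at
`0`, so that none is outer.
-/

noncomputable section

namespace HardyLorentz

/-! ### Superlevel functionals and weights as mixtures of `min t σ` -/

section Functionals

variable {α : Type*} [MeasurableSpace α]

/-- The functional `u ↦ ∫₀^∞ min (μ {u > τ}, s) dτ`, which for `u ≥ 0` is the integral `∫₀ˢ u*`
of the decreasing rearrangement, i.e. the K-functional of the couple `(L¹, L^∞)` at `s`. -/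
def kFunctional (μ : Measure α) (s : ℝ≥0∞) (u : α → ℝ) : ℝ≥0∞ :=
  ∫⁻ τ in Ioi (0 : ℝ), min (μ {x | τ < u x}) s

/-- The Choquet integral `∫₀^∞ φ (μ {u > τ}) dτ`: the Lorentz norm of a function `u ≥ 0`. -/
def choquet (φ : ℝ → ℝ) (μ : Measure α) (u : α → ℝ) : ℝ≥0∞ :=
  ∫⁻ τ in Ioi (0 : ℝ), ENNReal.ofReal (φ (μ.real {x | τ < u x}))

lemma antitone_measure_superlevel (μ : Measure α) (u : α → ℝ) :
    Antitone fun τ : ℝ => μ {x | τ < u x} :=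
  fun _ _ h => measure_mono fun _ hx => lt_of_le_of_lt h hx

/-- Layer cake formula for `(u - l)⁺`; the positive part is taken by `ENNReal.ofReal`. -/
lemma lintegral_Ioi_measure_superlevel {μ : Measure α} {u : α → ℝ} (hu : AEMeasurable u μ)
    (l : ℝ) : ∫⁻ τ in Ioi l, μ {x | τ < u x} = ∫⁻ x, ENNReal.ofReal (u x - l) ∂μ := by
  have h1 : ∫⁻ x, ENNReal.ofReal (u x - l) ∂μ = ∫⁻ x, ENNReal.ofReal (max (u x - l) 0) ∂μ := by
    refine lintegral_congr fun x => ?_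
    rcases le_total (u x - l) 0 with h | h
    · simp [h, ENNReal.ofReal_of_nonpos h]
    · simp [h]
  rw [h1, lintegral_eq_lintegral_meas_lt μ (f := fun x => max (u x - l) 0)
    (ae_of_all _ fun x => le_max_right _ _) ((hu.sub_const l).max aemeasurable_const)]
  have h2 : ∫⁻ t in Ioi (0 : ℝ), μ {a | t < max (u a - l) 0}
      = ∫⁻ t in Ioi (0 : ℝ), μ {a | t + l < u a} := by
    refine setLIntegral_congr_fun measurableSet_Ioi fun t ht => ?_
    congr 1
    ext a
    have : ¬ t < 0 := not_lt.2 (le_of_lt ht)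
    simp [this, lt_sub_iff_add_lt]
  have h3 := (measurePreserving_add_right volume l).setLIntegral_comp_preimage
    (s := Ioi l) measurableSet_Ioi (antitone_measure_superlevel μ u).measurable
  rw [h2, ← h3]
  congr 2
  ext t; simp

lemma kFunctional_le {μ : Measure α} {s : ℝ≥0∞} {u : α → ℝ} (hu : AEMeasurable u μ) {l : ℝ}
    (hl : 0 ≤ l) :
    kFunctional μ s u ≤ s * ENNReal.ofReal l + ∫⁻ x, ENNReal.ofReal (u x - l) ∂μ := by
  rw [kFunctional, ← Ioc_union_Ioi_eq_Ioi hl,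
    lintegral_union measurableSet_Ioi (Ioc_disjoint_Ioi le_rfl),
    ← lintegral_Ioi_measure_superlevel hu]
  gcongr
  · calc _ ≤ ∫⁻ _ in Ioc 0 l, s := lintegral_mono fun _ => min_le_right _ _
      _ = _ := by simp
  · exact min_le_left _ _

lemma kFunctional_le_lintegral {μ : Measure α} {s : ℝ≥0∞} {u : α → ℝ} (hu : AEMeasurable u μ) :
    kFunctional μ s u ≤ ∫⁻ x, ENNReal.ofReal (u x) ∂μ := by
  simpa using kFunctional_le (s := s) hu le_rfl

/-- The infimum in the formula `∫₀ˢ u* = inf_{l ≥ 0} (s l + ∫ (u - l)⁺)` is attained: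
`l = u*(s)` works. -/
lemma exists_kFunctional_eq {μ : Measure α} [IsFiniteMeasure μ] {s : ℝ≥0∞} (hs : s ≠ 0)
    {u : α → ℝ} (hu : AEMeasurable u μ) :
    ∃ l : ℝ, 0 ≤ l ∧
      kFunctional μ s u = s * ENNReal.ofReal l + ∫⁻ x, ENNReal.ofReal (u x - l) ∂μ := by
  set T : Set ℝ := {τ | 0 ≤ τ ∧ μ {x | τ < u x} ≤ s} with hT
  have hne : T.Nonempty := by
    have hnull : ∀ t : ℝ, NullMeasurableSet {x | t < u x} μ := fun t =>
      nullMeasurableSet_lt aemeasurable_const hu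
    have hlim : Tendsto (fun n : ℕ => μ {x | (n : ℝ) < u x}) atTop
        (𝓝 (μ (⋂ n : ℕ, {x | (n : ℝ) < u x}))) :=
      tendsto_measure_iInter_atTop (fun n => hnull n)
        (fun m n h x (hx : (n : ℝ) < u x) => lt_of_le_of_lt (Nat.cast_le.2 h) hx) ⟨0, measure_ne_top _ _⟩
    have hempty : (⋂ n : ℕ, {x | (n : ℝ) < u x}) = ∅ := by
      ext x
      obtain ⟨n, hn⟩ := exists_nat_ge (u x)
      simp only [mem_iInter, mem_ofPred_eq, mem_empty_iff_false, iff_false, not_forall, not_lt]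
      exact ⟨n, hn⟩
    rw [hempty, measure_empty] at hlim
    obtain ⟨n, hn⟩ := (hlim.eventually (Iio_mem_nhds (pos_iff_ne_zero.2 hs))).exists
    exact ⟨n, Nat.cast_nonneg n, le_of_lt hn⟩
  have hbdd : BddBelow T := ⟨0, fun _ h => h.1⟩
  have hl : 0 ≤ sInf T := le_csInf hne fun _ h => h.1
  refine ⟨sInf T, hl, ?_⟩
  rw [kFunctional, ← Ioc_union_Ioi_eq_Ioi hl,
    lintegral_union measurableSet_Ioi (Ioc_disjoint_Ioi le_rfl),
    ← lintegral_Ioi_measure_superlevel hu]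
  congr 1
  · rw [setLIntegral_congr Ioo_ae_eq_Ioc.symm]
    have : ∫⁻ τ in Ioo 0 (sInf T), min (μ {x | τ < u x}) s = ∫⁻ τ in Ioo 0 (sInf T), s := by
      refine setLIntegral_congr_fun measurableSet_Ioo fun t ht => min_eq_right ?_
      by_contra h
      exact absurd (csInf_le hbdd ⟨ht.1.le, (not_le.1 h).le⟩) (not_le.2 ht.2)
    rw [this]; simp
  · refine setLIntegral_congr_fun measurableSet_Ioi fun t ht => min_eq_left ?_
    obtain ⟨τ, hτ, hτt⟩ := exists_lt_of_csInf_lt hne ht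
    exact (antitone_measure_superlevel μ u hτt.le).trans hτ.2

@[simp] lemma kFunctional_zero_left (μ : Measure α) (u : α → ℝ) : kFunctional μ 0 u = 0 := by
  simp [kFunctional]

/-- Subadditivity and monotonicity of the K-functional at once: if `l` and `m` are optimal levels for
`v` and `w`, the level `a l + b m` is admissible for `u ≤ a v + b w`. -/
lemma kFunctional_le_add {μ : Measure α} [IsFiniteMeasure μ] {s : ℝ≥0∞} {u v w : α → ℝ}
    {a b : ℝ} (ha : 0 ≤ a) (hb : 0 ≤ b) (hu : AEMeasurable u μ)
    (hv : AEMeasurable v μ) (hw : AEMeasurable w μ) (h : ∀ᵐ x ∂μ, u x ≤ a * v x + b * w x) :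
    kFunctional μ s u ≤
      ENNReal.ofReal a * kFunctional μ s v + ENNReal.ofReal b * kFunctional μ s w := by
  rcases eq_or_ne s 0 with rfl | hs
  · simp
  obtain ⟨l, hl, hvl⟩ := exists_kFunctional_eq hs hv
  obtain ⟨m, hm, hwm⟩ := exists_kFunctional_eq hs hw
  have hlm : 0 ≤ a * l + b * m := by positivity
  have key : ∫⁻ x, ENNReal.ofReal (u x - (a * l + b * m)) ∂μ
      ≤ ENNReal.ofReal a * ∫⁻ x, ENNReal.ofReal (v x - l) ∂μ
        + ENNReal.ofReal b * ∫⁻ x, ENNReal.ofReal (w x - m) ∂μ := by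
    rw [← lintegral_const_mul'' _ (hv.sub_const l).ennreal_ofReal,
      ← lintegral_const_mul'' _ (hw.sub_const m).ennreal_ofReal,
      ← lintegral_add_left' ((hv.sub_const l).ennreal_ofReal.const_mul _)]
    refine lintegral_mono_ae (h.mono fun x hx => ?_)
    rw [← ENNReal.ofReal_mul ha, ← ENNReal.ofReal_mul hb]
    refine le_trans (ENNReal.ofReal_le_ofReal ?_) ENNReal.ofReal_add_le
    linarith
  refine (kFunctional_le hu hlm).trans ?_
  rw [hvl, hwm, ENNReal.ofReal_add (by positivity) (by positivity), ENNReal.ofReal_mul ha,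
    ENNReal.ofReal_mul hb]
  calc _ ≤ _ := add_le_add_right key _
    _ = _ := by ring

lemma kFunctional_le_add_lintegral {μ : Measure α} [IsFiniteMeasure μ] {s : ℝ≥0∞} {u v : α → ℝ}
    (hu : AEMeasurable u μ) (hv : AEMeasurable v μ) :
    kFunctional μ s u ≤ kFunctional μ s v + ∫⁻ x, ENNReal.ofReal |u x - v x| ∂μ := by
  have hd : AEMeasurable (fun x => |u x - v x|) μ := (hu.sub hv).abs
  have := kFunctional_le_add (s := s) zero_le_one zero_le_one hu hv hd
    (ae_of_all _ fun x => by linarith [le_abs_self (u x - v x)])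
  simp only [ENNReal.ofReal_one, one_mul] at this
  exact this.trans (add_le_add_right (kFunctional_le_lintegral hd) _)

lemma rightDeriv_antitoneOn {a : ℝ} {φ : ℝ → ℝ} (h : ConcaveOn ℝ (Icc 0 a) φ) :
    (∀ x ∈ Ioo 0 a, HasDerivWithinAt φ (derivWithin φ (Ioi x) x) (Ioi x) x) ∧
    AntitoneOn (fun x => derivWithin φ (Ioi x) x) (Ioo 0 a) := by
  have hn : ConvexOn ℝ (Icc 0 a) (-φ) := h.neg
  have e : ∀ x, derivWithin (-φ) (Ioi x) x = - derivWithin φ (Ioi x) x := fun x => by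
    simp [derivWithin.neg]
  refine ⟨fun x hx => ?_, fun x hx y hy hxy => ?_⟩
  · have := hn.hasDerivWithinAt_rightDeriv_of_mem_interior (x := x) (by rwa [interior_Icc])
    have := this.neg
    rw [e x, neg_neg, neg_neg] at this
    exact this
  · have := hn.monotoneOn_rightDeriv (by rwa [interior_Icc]) (by rwa [interior_Icc]) hxy
    simp only [e] at this
    exact neg_le_neg_iff.1 this

/-- A weight is a mixture of the extremal concave functions `t ↦ min t σ`. The layers of its right
derivative provide the mixture. -/
lemma LorentzWeight.exists_eq_lintegral_min {a : ℝ} (φ : LorentzWeight a) :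
    ∃ σ : ℝ → ℝ≥0∞, Measurable σ ∧
      ∀ t ∈ Icc 0 a, ENNReal.ofReal (φ t) = ∫⁻ η in Ioi (0 : ℝ), min (ENNReal.ofReal t) (σ η) := by
  obtain ⟨hd, hanti⟩ := rightDeriv_antitoneOn φ.concaveOn
  set k : ℝ → ℝ := fun x => derivWithin φ (Ioi x) x with hk
  have hk0 : ∀ x ∈ Ioo 0 a, 0 ≤ k x := by
    intro x hx
    have h1 := φ.concaveOn.slope_le_of_hasDerivWithinAt_Ioi (Ioo_subset_Icc_self hx)
      (right_mem_Icc.2 φ.pos.le) hx.2 (hd x hx)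
    refine le_trans ?_ h1
    rw [slope_def_field]
    exact div_nonneg (sub_nonneg.2 (φ.monotoneOn (Ioo_subset_Icc_self hx)
      (right_mem_Icc.2 φ.pos.le) hx.2.le)) (sub_nonneg.2 hx.2.le)
  have hint := intervalIntegral.integrableOn_deriv_right_of_nonneg φ.continuousOn hd hk0
  refine ⟨fun η => volume ({s | s ∈ Ioo 0 a ∧ η < k s}), ?_, fun t ht => ?_⟩
  · refine Antitone.measurable fun x y hxy => measure_mono fun s hs => ⟨hs.1, hxy.trans_lt hs.2⟩
  have hint' : IntegrableOn k (Ioc 0 t) := hint.mono_set (Ioc_subset_Ioc_right ht.2)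
  have hFTC : ∫ s in 0..t, k s = φ t - φ 0 :=
    intervalIntegral.integral_eq_sub_of_hasDeriv_right_of_le ht.1
      (φ.continuousOn.mono (Icc_subset_Icc_right ht.2))
      (fun x hx => hd x ⟨hx.1, hx.2.trans_le ht.2⟩)
      ((intervalIntegrable_iff_integrableOn_Ioc_of_le ht.1).2 hint')
  rw [φ.map_zero, sub_zero, intervalIntegral.integral_of_le ht.1,
    integral_Ioc_eq_integral_Ioo] at hFTC
  have hk0t : 0 ≤ᵐ[volume.restrict (Ioo 0 t)] k :=
    (ae_restrict_mem measurableSet_Ioo).mono fun x hx => hk0 x ⟨hx.1, hx.2.trans_le ht.2⟩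
  have hint'' : IntegrableOn k (Ioo 0 t) := hint'.mono_set Ioo_subset_Ioc_self
  rw [← hFTC, ofReal_integral_eq_lintegral_ofReal hint'' hk0t,
    lintegral_eq_lintegral_meas_lt _ hk0t hint''.aemeasurable]
  refine setLIntegral_congr_fun measurableSet_Ioi fun η _ => ?_
  rw [Measure.restrict_apply' measurableSet_Ioo]
  -- The set `{k > η}` is an initial segment of `(0, a)`, hence comparable with `(0, t)`.
  by_cases hcase : ∃ s ∈ Ioo 0 a, η < k s ∧ t ≤ s
  · obtain ⟨s, hs, hηs, hts⟩ := hcase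
    have hsub : Ioo 0 t ⊆ {s | s ∈ Ioo 0 a ∧ η < k s} := fun x hx =>
      ⟨⟨hx.1, hx.2.trans_le ht.2⟩,
        hηs.trans_le (hanti ⟨hx.1, hx.2.trans_le ht.2⟩ hs (hx.2.le.trans hts))⟩
    have hvol : volume (Ioo 0 t) = ENNReal.ofReal t := by simp
    rw [min_eq_left (hvol ▸ measure_mono hsub), ← hvol]
    congr 1
    exact inter_eq_self_of_subset_right fun x hx => (hsub hx).2
  · push Not at hcase
    have hsub : {s | s ∈ Ioo 0 a ∧ η < k s} ⊆ Ioo 0 t := fun x hx =>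
      ⟨hx.1.1, hcase x hx.1 hx.2⟩
    have hvol : volume (Ioo 0 t) = ENNReal.ofReal t := by simp
    rw [min_eq_right (hvol ▸ measure_mono hsub)]
    congr 1
    ext x
    exact ⟨fun hx => ⟨⟨hx.2.1, hx.2.2.trans_le ht.2⟩, hx.1⟩, fun hx => ⟨hx.2, hsub hx⟩⟩

end Functionals

/-! ### The Choquet integral: convexity, strict monotonicity and averaging -/

section Choquet

variable {α : Type*} [MeasurableSpace α] {μ : Measure α} {a : ℝ}

/-- The Lorentz norm is a mixture of K-functionals. This reduces convexity and semicontinuity of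
the Lorentz norm to the K-functionals. -/
lemma LorentzWeight.exists_choquet_eq (φ : LorentzWeight a) (μ : Measure α) [IsFiniteMeasure μ]
    (hμ : μ.real univ ≤ a) :
    ∃ σ : ℝ → ℝ≥0∞, Measurable σ ∧
      ∀ u : α → ℝ, choquet φ μ u = ∫⁻ η in Ioi (0 : ℝ), kFunctional μ (σ η) u := by
  obtain ⟨σ, hσ, h⟩ := φ.exists_eq_lintegral_min
  refine ⟨σ, hσ, fun u => ?_⟩
  have hd := (antitone_measure_superlevel μ u).measurable
  unfold kFunctional
  rw [lintegral_lintegral_swap]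
  · unfold choquet
    refine lintegral_congr fun τ => ?_
    rw [h _ ⟨measureReal_nonneg, (measureReal_mono (subset_univ _)).trans hμ⟩]
    refine lintegral_congr fun η => ?_
    rw [ofReal_measureReal]
  · exact ((hd.comp measurable_snd).min (hσ.comp measurable_fst)).aemeasurable

lemma measurable_kFunctional (μ : Measure α) (u : α → ℝ) :
    Measurable fun s => kFunctional μ s u :=
  Monotone.measurable fun _ _ h => lintegral_mono fun _ => min_le_min_left _ h

/-- The triangle inequality of the Lorentz norm, combined with its homogeneity and monotonicity. -/
lemma choquet_le_add (φ : LorentzWeight a) [IsFiniteMeasure μ] (hμ : μ.real univ ≤ a)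
    {u v w : α → ℝ} {b c : ℝ} (hb : 0 ≤ b) (hc : 0 ≤ c) (hu : AEMeasurable u μ)
    (hv : AEMeasurable v μ) (hw : AEMeasurable w μ) (h : ∀ᵐ x ∂μ, u x ≤ b * v x + c * w x) :
    choquet φ μ u ≤ ENNReal.ofReal b * choquet φ μ v + ENNReal.ofReal c * choquet φ μ w := by
  obtain ⟨σ, hσ, hr⟩ := φ.exists_choquet_eq μ hμ
  have hm : ∀ u, Measurable fun η => kFunctional μ (σ η) u := fun u =>
    (measurable_kFunctional μ u).comp hσ
  rw [hr, hr, hr, ← lintegral_const_mul _ (hm v), ← lintegral_const_mul _ (hm w),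
    ← lintegral_add_left ((hm v).const_mul _)]
  exact lintegral_mono fun η => kFunctional_le_add hb hc hu hv hw h

/-- Fatou property of the Lorentz norm, in terms of K-functionals. -/
lemma choquet_le_of_kFunctional_le_liminf (φ : LorentzWeight a) [IsFiniteMeasure μ]
    (hμ : μ.real univ ≤ a) {u : α → ℝ} {v : ℕ → α → ℝ} {C : ℝ≥0∞}
    (h : ∀ s, kFunctional μ s u ≤ liminf (fun n => kFunctional μ s (v n)) atTop)
    (hC : ∀ n, choquet φ μ (v n) ≤ C) : choquet φ μ u ≤ C := by
  obtain ⟨σ, hσ, hr⟩ := φ.exists_choquet_eq μ hμ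
  rw [hr]
  calc _ ≤ ∫⁻ η in Ioi (0 : ℝ), liminf (fun n => kFunctional μ (σ η) (v n)) atTop :=
        lintegral_mono fun η => h _
    _ ≤ liminf (fun n => ∫⁻ η in Ioi (0 : ℝ), kFunctional μ (σ η) (v n)) atTop :=
        lintegral_liminf_le fun n => (measurable_kFunctional μ (v n)).comp hσ
    _ ≤ C := by
        refine liminf_le_of_le (by isBoundedDefault) fun b hb => ?_
        obtain ⟨n, hn⟩ := hb.exists
        exact hn.trans ((hr (v n)).symm.trans_le (hC n))

lemma choquet_mono_of_kFunctional_le (φ : LorentzWeight a) [IsFiniteMeasure μ]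
    (hμ : μ.real univ ≤ a) {u v : α → ℝ} (h : ∀ s, kFunctional μ s u ≤ kFunctional μ s v) :
    choquet φ μ u ≤ choquet φ μ v := by
  obtain ⟨σ, hσ, hr⟩ := φ.exists_choquet_eq μ hμ
  rw [hr, hr]
  exact lintegral_mono fun η => h _

lemma measureReal_mem_Icc [IsFiniteMeasure μ] (hμ : μ.real univ ≤ a) (s : Set α) :
    μ.real s ∈ Icc 0 a :=
  ⟨measureReal_nonneg, (measureReal_mono (subset_univ _)).trans hμ⟩

lemma LorentzWeight.nonneg (φ : LorentzWeight a) {t : ℝ} (ht : t ∈ Icc 0 a) : 0 ≤ φ t :=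
  φ.map_zero ▸ φ.monotoneOn (left_mem_Icc.2 φ.pos.le) ht ht.1

lemma measurable_choquet_integrand (φ : LorentzWeight a) [IsFiniteMeasure μ]
    (hμ : μ.real univ ≤ a) (u : α → ℝ) :
    Measurable fun τ : ℝ => φ (μ.real {x | τ < u x}) :=
  Antitone.measurable fun _ _ h => φ.monotoneOn (measureReal_mem_Icc hμ _)
    (measureReal_mem_Icc hμ _) (measureReal_mono fun _ hx => lt_of_le_of_lt h hx)

/-- The Lorentz norm is strictly monotone when the weight is strictly increasing. -/
lemma ae_eq_of_le_of_choquet_le (φ : LorentzWeight a) (hmono : StrictMonoOn φ (Icc 0 a))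
    [IsFiniteMeasure μ] (hμ : μ.real univ ≤ a) {u v : α → ℝ} (hu0 : 0 ≤ᵐ[μ] u)
    (hu : AEMeasurable u μ) (hv : Integrable v μ) (huv : u ≤ᵐ[μ] v)
    (hfin : choquet φ μ u ≠ ∞) (h : choquet φ μ v ≤ choquet φ μ u) : u =ᵐ[μ] v := by
  have hd : ∀ τ : ℝ, μ {x | τ < u x} ≤ μ {x | τ < v x} := fun τ =>
    measure_mono_ae (huv.mono fun x hx (hτ : τ < u x) => lt_of_lt_of_le hτ hx)
  have hle : ∀ τ : ℝ, ENNReal.ofReal (φ (μ.real {x | τ < u x}))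
      ≤ ENNReal.ofReal (φ (μ.real {x | τ < v x})) := fun τ =>
    ENNReal.ofReal_le_ofReal (φ.monotoneOn (measureReal_mem_Icc hμ _) (measureReal_mem_Icc hμ _)
      (ENNReal.toReal_mono (measure_ne_top _ _) (hd τ)))
  have heq := ae_eq_of_ae_le_of_lintegral_le (ae_of_all _ hle) hfin
    (measurable_choquet_integrand φ hμ v).ennreal_ofReal.aemeasurable h
  have heq' : ∀ᵐ τ ∂(volume.restrict (Ioi (0 : ℝ))), μ {x | τ < u x} = μ {x | τ < v x} := by
    filter_upwards [heq] with τ hτ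
    rw [ENNReal.ofReal_eq_ofReal_iff (φ.nonneg (measureReal_mem_Icc hμ _))
      (φ.nonneg (measureReal_mem_Icc hμ _))] at hτ
    exact (ENNReal.toReal_eq_toReal_iff' (measure_ne_top _ _) (measure_ne_top _ _)).1
      (hmono.injOn (measureReal_mem_Icc hμ _) (measureReal_mem_Icc hμ _) hτ)
  have hint : ∫⁻ x, ENNReal.ofReal (u x) ∂μ = ∫⁻ x, ENNReal.ofReal (v x) ∂μ := by
    have h1 := lintegral_Ioi_measure_superlevel hu 0
    have h2 := lintegral_Ioi_measure_superlevel hv.aemeasurable 0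
    simp only [sub_zero] at h1 h2
    rw [← h1, ← h2]
    exact lintegral_congr_ae heq'
  have hfinv : ∫⁻ x, ENNReal.ofReal (v x) ∂μ ≠ ∞ := Integrable.lintegral_lt_top hv |>.ne
  have := ae_eq_of_ae_le_of_lintegral_le
    (huv.mono fun x hx => ENNReal.ofReal_le_ofReal hx) (hint ▸ hfinv)
    hv.aemeasurable.ennreal_ofReal hint.ge
  filter_upwards [this, hu0, huv] with x hx h0 hle
  exact (ENNReal.ofReal_eq_ofReal_iff h0 (h0.trans hle)).1 hx

lemma concaveOn_add_mul_le {φ : ℝ → ℝ} (h : ConcaveOn ℝ (Icc 0 a) φ) {p q s : ℝ} (hp : 0 ≤ p)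
    (hs : 0 < s) (hps : p + s ≤ a) (hq : q ∈ Icc 0 s) :
    φ p + q / s * (φ (p + s) - φ p) ≤ φ (p + q) := by
  have := h.2 (⟨hp, by linarith⟩ : p ∈ Icc 0 a)
    (⟨by linarith, hps⟩ : p + s ∈ Icc 0 a) (show 0 ≤ 1 - q / s by rw [sub_nonneg, div_le_one hs]; exact hq.2)
    (div_nonneg hq.1 hs.le) (by ring)
  simp only [smul_eq_mul] at this
  have e : (1 - q / s) * p + q / s * (p + s) = p + q := by field_simp; ring
  rw [e] at this
  linarith

lemma strictConcaveOn_add_mul_lt {φ : ℝ → ℝ} (h : StrictConcaveOn ℝ (Icc 0 a) φ) {p q s : ℝ}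
    (hp : 0 ≤ p) (hps : p + s ≤ a) (hq : q ∈ Ioo 0 s) :
    φ p + q / s * (φ (p + s) - φ p) < φ (p + q) := by
  have hs : 0 < s := hq.1.trans hq.2
  have := h.2 (⟨hp, by linarith⟩ : p ∈ Icc 0 a)
    (⟨by linarith, hps⟩ : p + s ∈ Icc 0 a) (by linarith) (show 0 < 1 - q / s by rw [sub_pos, div_lt_one hs]; exact hq.2)
    (div_pos hq.1 hs) (by ring)
  simp only [smul_eq_mul] at this
  have e : (1 - q / s) * p + q / s * (p + s) = p + q := by field_simp; ring
  rw [e] at this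
  linarith

/-- The increments of a concave function over intervals of a fixed length decrease. -/
lemma concaveOn_increment_antitone {φ : ℝ → ℝ} (h : ConcaveOn ℝ (Icc 0 a) φ) {p p' s : ℝ}
    (hp' : 0 ≤ p') (hs : 0 < s) (hps : p + s ≤ a) (hpp : p' ≤ p) :
    φ (p + s) - φ p ≤ φ (p' + s) - φ p' := by
  have hW : 0 < p - p' + s := by linarith
  have hW' : p' + (p - p' + s) = p + s := by ring
  have h1 := concaveOn_add_mul_le h hp' hW (q := s) (by linarith) ⟨hs.le, by linarith⟩
  have h2 := concaveOn_add_mul_le h hp' hW (q := p - p') (by linarith)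
    ⟨by linarith, by linarith⟩
  rw [hW'] at h1 h2
  rw [show p' + (p - p') = p by ring] at h2
  have : s / (p - p' + s) + (p - p') / (p - p' + s) = 1 := by field_simp; ring
  have h3 : s / (p - p' + s) * (φ (p + s) - φ p') + (p - p') / (p - p' + s) * (φ (p + s) - φ p')
      = φ (p + s) - φ p' := by rw [← add_mul, this, one_mul]
  linarith

open Classical in
/-- The function obtained from `v` by replacing its values on `S` by their mean over `S`. -/
def averageOn (μ : Measure α) (S : Set α) (v : α → ℝ) : α → ℝ :=
  S.piecewise (fun _ => ⨍ x in S, v x ∂μ) v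

lemma averageOn_of_mem {S : Set α} {x : α} (hx : x ∈ S) (v : α → ℝ) :
    averageOn μ S v x = ⨍ x in S, v x ∂μ := by
  simp [averageOn, hx]

lemma averageOn_of_notMem {S : Set α} {x : α} (hx : x ∉ S) (v : α → ℝ) :
    averageOn μ S v x = v x := by
  simp [averageOn, hx]

lemma aemeasurable_averageOn {S : Set α} (hS : MeasurableSet S) {v : α → ℝ}
    (hv : AEMeasurable v μ) : AEMeasurable (averageOn μ S v) μ := by
  have e : averageOn μ S v = S.indicator (fun _ => ⨍ x in S, v x ∂μ) + Sᶜ.indicator v := by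
    ext x
    by_cases hx : x ∈ S <;> simp [averageOn, hx]
  rw [e]
  exact (aemeasurable_const.indicator hS).add (hv.indicator hS.compl)

/-- The pointwise comparison of `φ (μ {v > τ})` with `φ (μ {averageOn μ S v > τ})`. Here
`p = μ ({v > τ} \ S)`, `q = μ ({v > τ} ∩ S)`, `s = μ S`, `c` is the mean value of `v` on `S` and
`p₀` is the value of `p` at `τ = c`. -/
lemma choquet_averageOn_pointwise {φ : ℝ → ℝ} (h : ConcaveOn ℝ (Icc 0 a) φ) {p p₀ q s τ c : ℝ}
    (hp : 0 ≤ p) (hp₀ : 0 ≤ p₀) (hs : 0 < s) (hps : p + s ≤ a) (hps₀ : p₀ + s ≤ a)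
    (hq : q ∈ Icc 0 s) (h1 : τ < c → p₀ ≤ p) (h2 : c ≤ τ → p ≤ p₀) :
    φ (p + if τ < c then s else 0) ≤
      φ (p + q) + (φ (p₀ + s) - φ p₀) * ((if τ < c then 1 else 0) - q / s) ∧
    (StrictConcaveOn ℝ (Icc 0 a) φ → φ (p + if τ < c then s else 0) =
      φ (p + q) + (φ (p₀ + s) - φ p₀) * ((if τ < c then 1 else 0) - q / s) → q = 0 ∨ q = s) := by
  have hq1 : q / s ≤ 1 := (div_le_one hs).2 hq.2
  have hq0 : 0 ≤ q / s := div_nonneg hq.1 hs.le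
  have key := concaveOn_add_mul_le h hp hs hps hq
  have aux : φ (p + if τ < c then s else 0) ≤ φ p + q / s * (φ (p + s) - φ p)
      + (φ (p₀ + s) - φ p₀) * ((if τ < c then 1 else 0) - q / s) := by
    split_ifs with hτ
    · have := concaveOn_increment_antitone h hp₀ hs hps (h1 hτ)
      nlinarith
    · have := concaveOn_increment_antitone h hp hs hps₀ (h2 (not_lt.1 hτ))
      rw [add_zero]
      nlinarith
  refine ⟨by linarith, fun hstrict heq => ?_⟩
  by_contra! hne
  have := strictConcaveOn_add_mul_lt hstrict hp hps
    ⟨lt_of_le_of_ne hq.1 hne.1.symm, lt_of_le_of_ne hq.2 hne.2⟩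
  linarith

/-- Averaging over `S` does not increase the Choquet integral. If it does not decrease it either and
the weight is strictly concave, almost every superlevel set of `v` is null or full in `S`. The right
side of `choquet_averageOn_pointwise` integrates to `choquet φ μ v`, because
`∫₀^∞ μ ({v > τ} ∩ S) dτ = μ S * c` makes the correction term vanish. -/
lemma choquet_averageOn_comparison (φ : LorentzWeight a) [IsFiniteMeasure μ] (hμ : μ.real univ ≤ a)
    {S : Set α} (hS : MeasurableSet S) (hS0 : μ S ≠ 0) {v : α → ℝ} (hv : Integrable v μ)
    (hv0 : 0 ≤ᵐ[μ] v) (hfin : choquet φ μ v ≠ ∞) :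
    choquet φ μ (averageOn μ S v) ≤ choquet φ μ v ∧
    (StrictConcaveOn ℝ (Icc 0 a) φ → choquet φ μ v ≤ choquet φ μ (averageOn μ S v) →
      ∀ᵐ τ ∂(volume.restrict (Ioi (0 : ℝ))),
        μ.real ({x | τ < v x} ∩ S) = 0 ∨ μ.real ({x | τ < v x} ∩ S) = μ.real S) := by
  set c := ⨍ x in S, v x ∂μ with hc
  set s := μ.real S with hs_def
  have hs : 0 < s := lt_of_le_of_ne measureReal_nonneg ((measureReal_ne_zero_iff).2 hS0).symm
  set p : ℝ → ℝ := fun τ => μ.real ({x | τ < v x} \ S) with hp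
  set q : ℝ → ℝ := fun τ => μ.real ({x | τ < v x} ∩ S) with hq
  have hc0 : 0 ≤ c := by
    rw [hc, setAverage_eq, smul_eq_mul]
    exact mul_nonneg (inv_nonneg.2 measureReal_nonneg)
      (integral_nonneg_of_ae (ae_restrict_of_ae hv0))
  have hdv : ∀ τ, μ.real {x | τ < v x} = p τ + q τ := fun τ => by
    rw [add_comm]
    exact (measureReal_inter_add_sdiff hS).symm
  have hda : ∀ τ, μ.real {x | τ < averageOn μ S v x} = p τ + if τ < c then s else 0 := by
    intro τ
    have h1 : {x | τ < averageOn μ S v x} \ S = {x | τ < v x} \ S := by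
      ext x
      by_cases hx : x ∈ S <;> simp [averageOn, hx]
    have h2 : {x | τ < averageOn μ S v x} ∩ S = if τ < c then S else ∅ := by
      ext x
      by_cases hx : x ∈ S <;> by_cases hτ : τ < c <;> simp [averageOn, hx, hτ, ← hc]
    rw [← measureReal_inter_add_sdiff hS, h1, h2, add_comm]
    congr 1
    split_ifs
    · rfl
    · exact measureReal_empty
  have hps : ∀ τ, p τ + s ≤ a := by
    intro τ
    have : p τ ≤ μ.real (univ \ S) := measureReal_mono (sdiff_subset_sdiff_left (subset_univ _))
    have h2 := measureReal_inter_add_sdiff (μ := μ) (s := univ) hS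
    rw [univ_inter] at h2
    linarith
  have hpanti : Antitone p := fun x y hxy => by
    exact measureReal_mono (sdiff_subset_sdiff_left fun z (hz : y < v z) => lt_of_le_of_lt hxy hz)
  have hqint : IntegrableOn q (Ioi 0) ∧ ∫ τ in Ioi 0, q τ = s * c := by
    have hvS : Integrable v (μ.restrict S) := hv.restrict
    have hv0S : 0 ≤ᵐ[μ.restrict S] v := ae_restrict_of_ae hv0
    have e : ∀ τ : ℝ, (μ.restrict S).real {x | τ < v x} = q τ := fun τ =>
      measureReal_restrict_apply' hS
    refine ⟨?_, ?_⟩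
    · have hmeas : Measurable q := Antitone.measurable fun x y hxy =>
        measureReal_mono (inter_subset_inter_left _ fun z (hz : y < v z) => lt_of_le_of_lt hxy hz)
      rw [IntegrableOn, ← lintegral_ofReal_ne_top_iff_integrable hmeas.aestronglyMeasurable
        (ae_of_all _ fun _ => measureReal_nonneg)]
      have := lintegral_eq_lintegral_meas_lt _ hv0S hvS.aemeasurable
      have e' : ∀ τ : ℝ, ENNReal.ofReal (q τ) = (μ.restrict S) {x | τ < v x} := fun τ => by
        rw [← e, ofReal_measureReal]
      rw [lintegral_congr e', ← this]
      exact (Integrable.lintegral_lt_top hvS).ne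
    · have := hvS.integral_eq_integral_meas_lt hv0S
      simp_rw [e] at this
      rw [← this, hc, setAverage_eq, smul_eq_mul, mul_inv_cancel_left₀ hs.ne']
  -- `R` is the pointwise upper bound; the factor of `D` in it has integral zero.
  set D := φ (p c + s) - φ (p c)
  set R : ℝ → ℝ := fun τ => φ (p τ + q τ) + D * ((if τ < c then 1 else 0) - q τ / s) with hR
  have hpt := fun τ => choquet_averageOn_pointwise φ.concaveOn (τ := τ) (c := c)
    (measureReal_nonneg : 0 ≤ p τ)
    (measureReal_nonneg : 0 ≤ p c) hs (hps τ) (hps c)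
    (q := q τ) ⟨measureReal_nonneg, measureReal_mono inter_subset_right⟩
    (fun h => hpanti h.le) (fun h => hpanti h)
  have hfint : IntegrableOn (fun τ => φ (p τ + q τ)) (Ioi 0) := by
    have hm := measurable_choquet_integrand φ hμ v
    simp_rw [hdv] at hm
    rw [IntegrableOn, ← lintegral_ofReal_ne_top_iff_integrable hm.aestronglyMeasurable
      (ae_of_all _ fun τ => φ.nonneg (hdv τ ▸ measureReal_mem_Icc hμ _))]
    unfold choquet at hfin
    simp_rw [hdv] at hfin
    exact hfin
  have hind : IntegrableOn (fun τ : ℝ => if τ < c then (1 : ℝ) else 0) (Ioi 0) ∧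
      ∫ τ in Ioi 0, (if τ < c then (1 : ℝ) else 0) = c := by
    have e : (fun τ : ℝ => if τ < c then (1 : ℝ) else 0) = (Iio c).indicator fun _ => 1 := by
      ext τ; simp [indicator]
    rw [e]
    constructor
    · rw [IntegrableOn, integrable_indicator_iff measurableSet_Iio, IntegrableOn,
        Measure.restrict_restrict measurableSet_Iio, Iio_inter_Ioi]
      exact integrableOn_const (by simp)
    · rw [setIntegral_indicator measurableSet_Iio, Ioi_inter_Iio, setIntegral_const]
      simp [Measure.real, hc0]
  have hRint : IntegrableOn R (Ioi 0) := by
    exact hfint.add ((hind.1.sub (hqint.1.div_const s)).const_mul D)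
  have hRv : ∫⁻ τ in Ioi 0, ENNReal.ofReal (R τ) = choquet φ μ v := by
    have hR0 : ∀ τ, 0 ≤ R τ := fun τ =>
      (φ.nonneg (hda τ ▸ measureReal_mem_Icc hμ _)).trans (hpt τ).1
    have hRi : ∫ τ in Ioi 0, R τ = ∫ τ in Ioi 0, φ (p τ + q τ) := by
      have h1 : ∫ τ in Ioi 0, R τ = (∫ τ in Ioi 0, φ (p τ + q τ)) +
          ∫ τ in Ioi 0, D * ((if τ < c then 1 else 0) - q τ / s) :=
        integral_add hfint ((hind.1.sub (hqint.1.div_const s)).const_mul D)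
      have h2 : ∫ τ in Ioi 0, ((if τ < c then 1 else 0) - q τ / s) =
          (∫ τ in Ioi 0, if τ < c then 1 else 0) - ∫ τ in Ioi 0, q τ / s :=
        integral_sub hind.1 (hqint.1.div_const s)
      rw [h1, integral_const_mul, h2, integral_div, hind.2, hqint.2,
        mul_div_cancel_left₀ _ hs.ne', sub_self, mul_zero, add_zero]
    rw [← ofReal_integral_eq_lintegral_ofReal hRint (ae_of_all _ hR0), hRi,
      ofReal_integral_eq_lintegral_ofReal hfint
        (ae_of_all _ fun τ => φ.nonneg (hdv τ ▸ measureReal_mem_Icc hμ _))]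
    unfold choquet
    simp_rw [hdv]
  have hav : choquet φ μ (averageOn μ S v)
      = ∫⁻ τ in Ioi (0 : ℝ), ENNReal.ofReal (φ (p τ + if τ < c then s else 0)) := by
    unfold choquet
    simp_rw [hda]
  refine ⟨?_, fun hstrict hle => ?_⟩
  · rw [hav, ← hRv]
    exact lintegral_mono fun τ => ENNReal.ofReal_le_ofReal (hpt τ).1
  · rw [hav, ← hRv] at hle
    have hRfin : ∫⁻ τ in Ioi 0, ENNReal.ofReal (R τ) ≠ ∞ := hRv ▸ hfin
    have hae := ae_eq_of_ae_le_of_lintegral_le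
      (ae_of_all _ fun τ => ENNReal.ofReal_le_ofReal (hpt τ).1)
      (ne_top_of_le_ne_top hRfin (lintegral_mono fun τ => ENNReal.ofReal_le_ofReal (hpt τ).1))
      hRint.aemeasurable.ennreal_ofReal hle
    filter_upwards [hae] with τ hτ
    have h0 := φ.nonneg (hda τ ▸ measureReal_mem_Icc hμ _)
    exact (hpt τ).2 hstrict ((ENNReal.ofReal_eq_ofReal_iff h0 (h0.trans (hpt τ).1)).1 hτ)

lemma choquet_averageOn_le (φ : LorentzWeight a) [IsFiniteMeasure μ] (hμ : μ.real univ ≤ a)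
    {S : Set α} (hS : MeasurableSet S) (hS0 : μ S ≠ 0) {v : α → ℝ} (hv : Integrable v μ)
    (hv0 : 0 ≤ᵐ[μ] v) : choquet φ μ (averageOn μ S v) ≤ choquet φ μ v := by
  by_cases hfin : choquet φ μ v = ∞
  · rw [hfin]; exact le_top
  · exact (choquet_averageOn_comparison φ hμ hS hS0 hv hv0 hfin).1

/-- For a strictly concave weight, averaging over a set strictly diminishes the Lorentz norm of
every function that is not constant on the set. -/
lemma ae_eq_average_of_choquet_le (φ : LorentzWeight a) (hconc : StrictConcaveOn ℝ (Icc 0 a) φ)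
    [IsFiniteMeasure μ] (hμ : μ.real univ ≤ a)
    {S : Set α} (hS : MeasurableSet S) (hS0 : μ S ≠ 0) {v : α → ℝ} (hv : Integrable v μ)
    (hv0 : 0 ≤ᵐ[μ] v) (hfin : choquet φ μ v ≠ ∞)
    (h : choquet φ μ v ≤ choquet φ μ (averageOn μ S v)) :
    ∀ᵐ x ∂(μ.restrict S), v x = ⨍ x in S, v x ∂μ := by
  have hT := (choquet_averageOn_comparison φ hμ hS hS0 hv hv0 hfin).2 hconc h
  set c := ⨍ x in S, v x ∂μ with hc
  have hs : 0 < μ.real S :=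
    lt_of_le_of_ne measureReal_nonneg ((measureReal_ne_zero_iff).2 hS0).symm
  have hsum : ∫ x in S, v x ∂μ = μ.real S * c := by
    rw [hc, setAverage_eq, smul_eq_mul, mul_inv_cancel_left₀ hs.ne']
  have hvS : Integrable v (μ.restrict S) := hv.restrict
  have hc0 : 0 ≤ c := by
    have := integral_nonneg_of_ae (ae_restrict_of_ae (s := S) hv0)
    rw [hsum] at this
    exact nonneg_of_mul_nonneg_right this hs
  -- Above the mean the superlevel sets of `v` in `S` cannot be full, hence are null.
  have hlevel : ∀ n : ℕ, ∀ᵐ x ∂(μ.restrict S), v x ≤ c + 1 / ((n : ℝ) + 1) := by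
    intro n
    have hpos : (0 : ℝ) < 1 / ((n : ℝ) + 1) := by positivity
    have hex : ∃ τ ∈ Ioo c (c + 1 / ((n : ℝ) + 1)),
        μ.real ({x | τ < v x} ∩ S) = 0 ∨ μ.real ({x | τ < v x} ∩ S) = μ.real S := by
      by_contra! hne
      rw [ae_restrict_iff' measurableSet_Ioi] at hT
      have : volume (Ioo c (c + 1 / ((n : ℝ) + 1))) = 0 := by
        refine measure_mono_null (fun τ hτ => ?_) hT
        intro hcon
        have := hcon (hc0.trans_lt hτ.1)
        exact absurd this (not_or.2 (hne τ hτ))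
      rw [Real.volume_Ioo, ENNReal.ofReal_eq_zero] at this
      linarith
    obtain ⟨τ, hτ, h0 | h1⟩ := hex
    · have hnull : (μ.restrict S) {x | τ < v x} = 0 := by
        rw [Measure.restrict_apply' hS]
        exact (measureReal_eq_zero_iff).1 h0
      have : ∀ᵐ x ∂(μ.restrict S), ¬ τ < v x := by
        rw [ae_iff]; simpa using hnull
      filter_upwards [this] with x hx
      exact (not_lt.1 hx).trans hτ.2.le
    · exfalso
      have hmk : τ * (μ.restrict S).real {x | τ ≤ v x} ≤ ∫ x in S, v x ∂μ :=
        mul_meas_ge_le_integral_of_nonneg (ae_restrict_of_ae hv0) hvS τ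
      have hge : μ.real S ≤ (μ.restrict S).real {x | τ ≤ v x} := by
        rw [measureReal_restrict_apply' hS, ← h1]
        exact measureReal_mono (inter_subset_inter_left _ fun x (hx : τ < v x) => hx.le)
      rw [hsum] at hmk
      have hτ0 : 0 ≤ τ := hc0.trans hτ.1.le
      nlinarith [mul_le_mul_of_nonneg_left hge hτ0, mul_lt_mul_of_pos_right hτ.1 hs]
  have hle : ∀ᵐ x ∂(μ.restrict S), v x ≤ c := by
    filter_upwards [ae_all_iff.2 hlevel] with x hx
    refine ge_of_tendsto' (x := atTop) (f := fun n : ℕ => c + 1 / ((n : ℝ) + 1)) ?_ hx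
    simpa using tendsto_one_div_add_atTop_nhds_zero_nat.const_add c
  have hci : Integrable (fun _ : α => c) (μ.restrict S) := integrable_const c
  have hzero : ∫ x in S, (c - v x) ∂μ = 0 := by
    rw [integral_sub hci hvS, hsum, setIntegral_const, smul_eq_mul, sub_self]
  rw [integral_eq_zero_iff_of_nonneg_ae (hle.mono fun x hx => sub_nonneg.2 hx)
    (hci.sub hvS)] at hzero
  filter_upwards [hzero] with x hx
  exact (sub_eq_zero.1 hx).symm

end Choquet

/-! ### The Lorentz norm as a Choquet integral -/

section LorentzNorm

variable {a : ℝ}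

lemma rearrangement_antitone (a : ℝ) (x : ℝ → ℂ) : Antitone (rearrangement a x) := by
  intro s t hst
  refine le_iInf₂ fun τ hτ => iInf₂_le τ (hτ.trans (ENNReal.ofReal_le_ofReal hst))

/-- The infimum that defines the rearrangement is attained, so `x*` and the distribution function of
`|x|` are generalised inverses of each other. -/
lemma rearrangement_le_iff {x : ℝ → ℂ} {t : ℝ} {τ : ℝ≥0} :
    rearrangement a x t ≤ τ ↔ volume {s | s ∈ Icc 0 a ∧ τ < ‖x s‖₊} ≤ ENNReal.ofReal t := by
  refine ⟨fun h => ?_, fun h => iInf₂_le τ h⟩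
  have hn : ∀ n : ℕ, volume {s | s ∈ Icc 0 a ∧ τ + 1 / ((n : ℝ≥0) + 1) < ‖x s‖₊}
      ≤ ENNReal.ofReal t := by
    intro n
    have hlt : rearrangement a x t < ((τ + 1 / ((n : ℝ≥0) + 1) : ℝ≥0) : ℝ≥0∞) :=
      h.trans_lt (ENNReal.coe_lt_coe.2 (lt_add_of_pos_right _ (by positivity)))
    unfold rearrangement at hlt
    simp only [iInf_lt_iff] at hlt
    obtain ⟨σ, hσ, hlt⟩ := hlt
    refine le_trans (measure_mono ?_) hσ
    exact fun s hs => ⟨hs.1, (ENNReal.coe_lt_coe.1 hlt).trans hs.2⟩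
  have hU : {s | s ∈ Icc 0 a ∧ τ < ‖x s‖₊}
      = ⋃ n : ℕ, {s | s ∈ Icc 0 a ∧ τ + 1 / ((n : ℝ≥0) + 1) < ‖x s‖₊} := by
    ext s
    simp only [mem_ofPred_eq, mem_iUnion]
    refine ⟨fun hs => ?_, fun ⟨n, hs⟩ => ⟨hs.1, lt_of_le_of_lt (by simp) hs.2⟩⟩
    have hpos : 0 < ‖x s‖₊ - τ := tsub_pos_of_lt hs.2
    obtain ⟨n, hn⟩ := exists_nat_one_div_lt (K := ℝ) (NNReal.coe_pos.2 hpos)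
    refine ⟨n, hs.1, ?_⟩
    have hn' : 1 / ((n : ℝ≥0) + 1) < ‖x s‖₊ - τ := by exact_mod_cast hn
    rw [add_comm]
    exact lt_tsub_iff_right.1 hn'
  have hmono : Monotone fun n : ℕ => {s | s ∈ Icc 0 a ∧ τ + 1 / ((n : ℝ≥0) + 1) < ‖x s‖₊} := by
    intro m n hmn s hs
    refine ⟨hs.1, lt_of_le_of_lt ?_ hs.2⟩
    gcongr
  rw [hU, hmono.measure_iUnion]
  exact iSup_le hn

lemma LorentzWeight.stieltjes_measure_Ioo (φ : LorentzWeight a) {t : ℝ} (ht : t ∈ Icc 0 a) :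
    φ.stieltjes.measure (Ioo 0 t) = ENNReal.ofReal (φ t) := by
  have happ : ∀ s ∈ Icc 0 a, φ.stieltjes s = φ s := fun s hs => by
    change φ (projIcc 0 a φ.pos.le s) = φ s
    rw [projIcc_of_mem _ hs]
  have hcont : Continuous φ.stieltjes :=
    φ.continuousOn.comp_continuous (continuous_subtype_val.comp continuous_projIcc)
      (fun s => (projIcc 0 a φ.pos.le s).2)
  rw [StieltjesFunction.measure_Ioo, hcont.continuousAt.continuousWithinAt.leftLim_eq, happ t ht,
    happ 0 (left_mem_Icc.2 φ.pos.le), φ.map_zero, sub_zero]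

/-- Layer cake formula for the Lorentz norm. -/
lemma lorentzNorm_eq_choquet (φ : LorentzWeight a) {x : ℝ → ℂ} {M : ℝ}
    (hM : ∀ s ∈ Icc 0 a, ‖x s‖ ≤ M) :
    lorentzNorm φ x = choquet φ (volume.restrict (Icc 0 a)) fun s => ‖x s‖ := by
  have hfin : ∀ t, rearrangement a x t ≠ ∞ := fun t => by
    refine ne_top_of_le_ne_top (ENNReal.coe_ne_top (r := M.toNNReal)) ?_
    rw [rearrangement_le_iff]
    refine le_of_eq_of_le ?_ zero_le
    convert measure_empty (μ := volume)
    ext s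
    simp only [mem_ofPred_eq, mem_empty_iff_false, iff_false, not_and, not_lt]
    exact fun hs => NNReal.coe_le_coe.1 (le_trans (hM s hs) (Real.le_coe_toNNReal M))
  have hanti : Antitone fun t => (rearrangement a x t).toReal := fun s t hst =>
    ENNReal.toReal_mono (hfin s) (rearrangement_antitone a x hst)
  unfold lorentzNorm
  have e : ∀ t, rearrangement a x t = ENNReal.ofReal (rearrangement a x t).toReal := fun t =>
    (ENNReal.ofReal_toReal (hfin t)).symm
  rw [lintegral_congr e, lintegral_eq_lintegral_meas_lt _ (ae_of_all _ fun t => ENNReal.toReal_nonneg)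
    hanti.measurable.aemeasurable]
  refine setLIntegral_congr_fun measurableSet_Ioi fun τ hτ => ?_
  rw [Measure.restrict_apply' measurableSet_Ioc, measureReal_restrict_apply' measurableSet_Icc]
  lift τ to ℝ≥0 using le_of_lt hτ
  have hset : {s : ℝ | s ∈ Icc 0 a ∧ τ < ‖x s‖₊} = {s | (τ : ℝ) < ‖x s‖} ∩ Icc 0 a := by
    ext s; exact and_comm
  have hsub : volume ({s | (τ : ℝ) < ‖x s‖} ∩ Icc 0 a) ≤ ENNReal.ofReal a := by
    refine (measure_mono inter_subset_right).trans ?_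
    simp
  have hmem : volume.real ({s | (τ : ℝ) < ‖x s‖} ∩ Icc 0 a) ∈ Icc 0 a :=
    ⟨measureReal_nonneg, ENNReal.toReal_le_of_le_ofReal φ.pos.le hsub⟩
  rw [← φ.stieltjes_measure_Ioo hmem]
  congr 1
  ext t
  have hiff : (τ : ℝ) < (rearrangement a x t).toReal ↔
      ENNReal.ofReal t < volume ({s | (τ : ℝ) < ‖x s‖} ∩ Icc 0 a) := by
    rw [← hset, ← not_le (a := volume _), ← rearrangement_le_iff, not_le,
      ← ENNReal.toReal_lt_toReal ENNReal.coe_ne_top (hfin t)]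
    simp
  simp only [mem_inter_iff, mem_ofPred_eq, mem_Ioc, mem_Ioo, hiff]
  constructor
  · rintro ⟨h1, h2, h3⟩
    exact ⟨h2, (ENNReal.ofReal_lt_iff_lt_toReal h2.le (ne_top_of_le_ne_top (by simp) hsub)).1 h1⟩
  · rintro ⟨h1, h2⟩
    exact ⟨(ENNReal.ofReal_lt_iff_lt_toReal h1.le (ne_top_of_le_ne_top (by simp) hsub)).2 h2,
      h1, h2.le.trans hmem.2⟩

/-- The Lorentz norm dominates the `L¹` norm, as `φ t ≥ t / a` by concavity. -/
lemma lintegral_le_choquet (φ : LorentzWeight a) {μ : Measure ℝ} [IsFiniteMeasure μ]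
    (hμ : μ.real univ ≤ a) {u : ℝ → ℝ} (hu : AEMeasurable u μ) (hu0 : 0 ≤ᵐ[μ] u) :
    ∫⁻ x, ENNReal.ofReal (u x) ∂μ ≤ ENNReal.ofReal a * choquet φ μ u := by
  rw [lintegral_eq_lintegral_meas_lt μ hu0 hu, choquet, ← lintegral_const_mul' _ _ (by simp)]
  refine lintegral_mono fun τ => ?_
  have hm := measureReal_mem_Icc (μ := μ) hμ {x | τ < u x}
  have h0 := φ.pos
  have hφ : μ.real {x | τ < u x} / a ≤ φ (μ.real {x | τ < u x}) := by
    have := concaveOn_add_mul_le φ.concaveOn le_rfl h0 (by simp) hm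
    simpa [φ.map_zero, φ.map_right] using this
  rw [← ENNReal.ofReal_mul h0.le, ← ofReal_measureReal]
  refine ENNReal.ofReal_le_ofReal ?_
  rw [div_le_iff₀ h0] at hφ
  linarith

lemma choquet_le_of_bounded (φ : LorentzWeight a) {μ : Measure ℝ} [IsFiniteMeasure μ]
    (hμ : μ.real univ ≤ a) {u : ℝ → ℝ} {M : ℝ} (hM : ∀ᵐ x ∂μ, u x ≤ M) :
    choquet φ μ u ≤ ENNReal.ofReal M := by
  have : ∀ τ, ENNReal.ofReal (φ (μ.real {x | τ < u x})) ≤ (Iio M).indicator (fun _ => 1) τ := by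
    intro τ
    by_cases h : τ < M
    · rw [indicator_of_mem (mem_Iio.2 h), ENNReal.ofReal_le_one, ← φ.map_right]
      exact φ.monotoneOn (measureReal_mem_Icc hμ _) (right_mem_Icc.2 φ.pos.le)
        (measureReal_mem_Icc hμ _).2
    · have h0 : μ {x | τ < u x} = 0 := by
        refine measure_mono_null (fun x (hx : τ < u x) => ?_) hM
        exact fun hle => h (hx.trans_le hle)
      simp [Measure.real, h0, φ.map_zero]
  calc _ ≤ ∫⁻ τ in Ioi (0 : ℝ), (Iio M).indicator (fun _ => 1) τ := lintegral_mono this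
    _ = _ := by
      rw [lintegral_indicator measurableSet_Iio, Measure.restrict_restrict measurableSet_Iio,
        Iio_inter_Ioi]
      simp

lemma choquet_const_mul (φ : LorentzWeight a) {α : Type*} [MeasurableSpace α] {μ : Measure α}
    [IsFiniteMeasure μ] (hμ : μ.real univ ≤ a) {u : α → ℝ} (hu : AEMeasurable u μ)
    {c : ℝ} (hc : 0 < c) :
    choquet φ μ (fun x => c * u x) = ENNReal.ofReal c * choquet φ μ u := by
  have key : ∀ {v w : α → ℝ} {c : ℝ}, AEMeasurable v μ → AEMeasurable w μ → 0 ≤ c →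
      (∀ x, v x = c * w x) → choquet φ μ v ≤ ENNReal.ofReal c * choquet φ μ w := by
    intro v w c hv hw hc h
    simpa using choquet_le_add φ hμ hc le_rfl hv hw hw
      (ae_of_all _ fun x => by rw [h x, zero_mul, add_zero])
  refine le_antisymm (key (hu.const_mul c) hu hc.le fun _ => rfl) ?_
  have h2 := key hu (hu.const_mul c) (inv_nonneg.2 hc.le) fun x =>
    (inv_mul_cancel_left₀ hc.ne' _).symm
  calc _ ≤ ENNReal.ofReal c * (ENNReal.ofReal c⁻¹ * choquet φ μ fun x => c * u x) := by gcongr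
    _ = _ := by
      rw [← mul_assoc, ← ENNReal.ofReal_mul hc.le, mul_inv_cancel₀ hc.ne', ENNReal.ofReal_one,
        one_mul]

end LorentzNorm

/-! ### Poisson kernel and integral means over circles -/

section Circle

/-- Lebesgue measure on `[0, 2π]`, the parameter interval of the unit circle. -/
abbrev circleVolume : Measure ℝ := volume.restrict (Icc 0 (2 * Real.pi))

lemma circleVolume_real_univ_le : circleVolume.real univ ≤ 2 * Real.pi := by
  simp [Measure.real, Real.pi_pos.le]

lemma integral_circleVolume {E : Type*} [NormedAddCommGroup E] [NormedSpace ℝ E] (f : ℝ → E) :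
    ∫ t, f t ∂circleVolume = ∫ t in 0..2 * Real.pi, f t := by
  rw [integral_Icc_eq_integral_Ioc, intervalIntegral.integral_of_le (by positivity)]

lemma circleAverage_eq_integral {E : Type*} [NormedAddCommGroup E] [NormedSpace ℝ E] (f : ℂ → E)
    (R : ℝ) :
    Real.circleAverage f 0 R =
      (2 * Real.pi)⁻¹ • ∫ t, f (circleMap 0 R t) ∂circleVolume := by
  rw [Real.circleAverage_def, integral_circleVolume]

lemma poissonKernel_nonneg {r R : ℝ} (hr : 0 ≤ r) (hrR : r ≤ R) (s t : ℝ) :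
    0 ≤ poissonKernel 0 (circleMap 0 r t) (circleMap 0 R s) := by
  rw [poissonKernel_def]
  refine div_nonneg ?_ (by positivity)
  simp only [sub_zero, norm_circleMap_zero, sq_abs]
  nlinarith

lemma poissonKernel_circleMap_comm (r R s t : ℝ) :
    poissonKernel 0 (circleMap 0 r t) (circleMap 0 R s)
      = poissonKernel 0 (circleMap 0 r s) (circleMap 0 R t) := by
  simp only [poissonKernel_def, sub_zero, norm_circleMap_zero]
  have h : ∀ x y : ℝ, ‖circleMap 0 R x - circleMap 0 r y‖ ^ 2
      = R ^ 2 + r ^ 2 - 2 * R * r * Real.cos (x - y) := by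
    intro x y
    rw [← Complex.normSq_eq_norm_sq, Complex.normSq_apply]
    simp only [circleMap_zero, Complex.sub_re, Complex.sub_im, Complex.mul_re, Complex.mul_im,
      Complex.ofReal_re, Complex.ofReal_im, Complex.exp_ofReal_mul_I_re,
      Complex.exp_ofReal_mul_I_im, Real.cos_sub]
    have h1 := Real.sin_sq_add_cos_sq x
    have h2 := Real.sin_sq_add_cos_sq y
    linear_combination R ^ 2 * h1 + r ^ 2 * h2
  rw [h, h, ← Real.cos_neg (s - t), neg_sub]

lemma continuous_poissonKernel_circleMap {r R : ℝ} (hr : 0 ≤ r) (hrR : r < R) :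
    Continuous fun p : ℝ × ℝ => poissonKernel 0 (circleMap 0 r p.1) (circleMap 0 R p.2) := by
  simp only [poissonKernel_def, sub_zero]
  have hc : ∀ ρ : ℝ, Continuous fun t : ℝ => circleMap 0 ρ t := fun ρ => by fun_prop
  refine Continuous.div ?_ ?_ fun p => ?_
  · exact (((hc R).comp continuous_snd).norm.pow 2).sub (((hc r).comp continuous_fst).norm.pow 2)
  · exact (((hc R).comp continuous_snd).sub ((hc r).comp continuous_fst)).norm.pow 2
  · have h1 := norm_sub_norm_le (circleMap 0 R p.2) (circleMap 0 r p.1)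
    rw [norm_circleMap_zero, norm_circleMap_zero, abs_of_nonneg hr,
      abs_of_nonneg (hr.trans hrR.le)] at h1
    have : 0 < ‖circleMap 0 R p.2 - circleMap 0 r p.1‖ := by linarith
    positivity

lemma integral_poissonKernel {r R : ℝ} (hr : 0 ≤ r) (hrR : r < R) (t : ℝ) :
    ∫ s, poissonKernel 0 (circleMap 0 r t) (circleMap 0 R s) ∂circleVolume = 2 * Real.pi := by
  have hw : circleMap 0 r t ∈ Metric.ball (0 : ℂ) R := by
    rw [mem_ball_zero_iff, norm_circleMap_zero, abs_of_nonneg hr]; exact hrR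
  have h := DiffContOnCl.circleAverage_poissonKernel_smul (f := fun _ => (1 : ℂ))
    diffContOnCl_const hw
  rw [circleAverage_eq_integral] at h
  simp only [Pi.smul_apply', Complex.real_smul, mul_one] at h
  rw [integral_complex_ofReal] at h
  have h' : (2 * Real.pi)⁻¹ *
      ∫ s, poissonKernel 0 (circleMap 0 r t) (circleMap 0 R s) ∂circleVolume = 1 := by
    exact_mod_cast h
  have := Real.pi_pos
  field_simp at h'
  linarith

lemma integrable_circleVolume {E : Type*} [NormedAddCommGroup E] {F : ℝ → E} (hF : Continuous F) :
    Integrable F circleVolume :=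
  hF.continuousOn.integrableOn_Icc

/-- The density of harmonic measure: `poissonDensity r R t s ds` is the harmonic measure of the
disc of radius `R` at the point `r e^{it}`, in the parameter `s` of the boundary circle. -/
def poissonDensity (r R t s : ℝ) : ℝ :=
  (2 * Real.pi)⁻¹ * poissonKernel 0 (circleMap 0 r t) (circleMap 0 R s)

lemma poissonDensity_nonneg {r R : ℝ} (hr : 0 ≤ r) (hrR : r ≤ R) (t s : ℝ) :
    0 ≤ poissonDensity r R t s :=
  mul_nonneg (by positivity) (poissonKernel_nonneg hr hrR s t)

lemma poissonDensity_comm (r R t s : ℝ) : poissonDensity r R t s = poissonDensity r R s t := by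
  rw [poissonDensity, poissonKernel_circleMap_comm, poissonDensity]

lemma continuous_poissonDensity {r R : ℝ} (hr : 0 ≤ r) (hrR : r < R) :
    Continuous fun p : ℝ × ℝ => poissonDensity r R p.1 p.2 :=
  (continuous_poissonKernel_circleMap hr hrR).const_mul _

lemma continuous_poissonDensity_right {r R : ℝ} (hr : 0 ≤ r) (hrR : r < R) (t : ℝ) :
    Continuous (poissonDensity r R t) := by
  have h := continuous_poissonDensity hr hrR
  have h2 : Continuous fun s : ℝ => (t, s) := by fun_prop
  exact (h.comp h2).congr fun s => rfl

lemma integral_poissonDensity {r R : ℝ} (hr : 0 ≤ r) (hrR : r < R) (t : ℝ) :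
    ∫ s, poissonDensity r R t s ∂circleVolume = 1 := by
  unfold poissonDensity
  rw [integral_const_mul, integral_poissonKernel hr hrR, inv_mul_cancel₀ (by positivity)]

lemma lintegral_poissonDensity_left {r R : ℝ} (hr : 0 ≤ r) (hrR : r < R) (s : ℝ) :
    ∫⁻ t, ENNReal.ofReal (poissonDensity r R t s) ∂circleVolume = 1 := by
  rw [lintegral_congr fun t => by rw [poissonDensity_comm],
    ← ofReal_integral_eq_lintegral_ofReal
      (integrable_circleVolume (continuous_poissonDensity_right hr hrR s))
      (ae_of_all _ (poissonDensity_nonneg hr hrR.le s)), integral_poissonDensity hr hrR,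
    ENNReal.ofReal_one]

lemma norm_circleMap_le_integral {g : ℂ → ℂ} {r R : ℝ} (hr : 0 ≤ r) (hrR : r < R)
    (hg : DiffContOnCl ℂ g (Metric.ball 0 R)) (t : ℝ) :
    ‖g (circleMap 0 r t)‖
      ≤ ∫ s, poissonDensity r R t s * ‖g (circleMap 0 R s)‖ ∂circleVolume := by
  have hw : circleMap 0 r t ∈ Metric.ball (0 : ℂ) R := by
    rw [mem_ball_zero_iff, norm_circleMap_zero, abs_of_nonneg hr]; exact hrR
  have h := DiffContOnCl.circleAverage_poissonKernel_smul hg hw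
  rw [circleAverage_eq_integral, ← integral_smul] at h
  rw [← h]
  refine (norm_integral_le_integral_norm _).trans (le_of_eq (integral_congr_ae
    (ae_of_all _ fun s => ?_)))
  simp only [Pi.smul_apply', norm_smul, poissonDensity]
  rw [Real.norm_of_nonneg (by positivity),
    Real.norm_of_nonneg (poissonKernel_nonneg hr hrR.le s t), mul_assoc]

/-- The sub-mean value property of `(|g| - l)⁺` with respect to harmonic measure. -/
lemma ofReal_norm_sub_le_lintegral {g : ℂ → ℂ} {r R : ℝ} (hr : 0 ≤ r) (hrR : r < R)
    (hg : DiffContOnCl ℂ g (Metric.ball 0 R)) (hgc : Continuous fun s => g (circleMap 0 R s))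
    (l t : ℝ) :
    ENNReal.ofReal (‖g (circleMap 0 r t)‖ - l) ≤ ∫⁻ s, ENNReal.ofReal (poissonDensity r R t s) *
      ENNReal.ofReal (‖g (circleMap 0 R s)‖ - l) ∂circleVolume := by
  set m : ℝ → ℝ := fun s => max (‖g (circleMap 0 R s)‖ - l) 0 with hm
  have hmc : Continuous m := (hgc.norm.sub continuous_const).max continuous_const
  have hkc := continuous_poissonDensity_right hr hrR t
  have h1 := norm_circleMap_le_integral hr hrR hg t
  have h2 : ∫ s, poissonDensity r R t s * ‖g (circleMap 0 R s)‖ ∂circleVolume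
      ≤ ∫ s, (poissonDensity r R t s * m s + l * poissonDensity r R t s) ∂circleVolume := by
    refine integral_mono (integrable_circleVolume (hkc.mul hgc.norm))
      (integrable_circleVolume ((hkc.mul hmc).add (hkc.const_mul l))) fun s => ?_
    have h3 : ‖g (circleMap 0 R s)‖ - l ≤ m s := le_max_left _ _
    have h4 := mul_le_mul_of_nonneg_left h3 (poissonDensity_nonneg hr hrR.le t s)
    linarith
  have h5 : ∫ s, (poissonDensity r R t s * m s + l * poissonDensity r R t s) ∂circleVolume
      = (∫ s, poissonDensity r R t s * m s ∂circleVolume)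
        + ∫ s, l * poissonDensity r R t s ∂circleVolume :=
    integral_add (integrable_circleVolume (hkc.mul hmc)) (integrable_circleVolume (hkc.const_mul l))
  rw [h5, integral_const_mul, integral_poissonDensity hr hrR, mul_one] at h2
  calc _ ≤ ENNReal.ofReal (∫ s, poissonDensity r R t s * m s ∂circleVolume) :=
        ENNReal.ofReal_le_ofReal (by linarith)
    _ = ∫⁻ s, ENNReal.ofReal (poissonDensity r R t s * m s) ∂circleVolume :=
        ofReal_integral_eq_lintegral_ofReal (integrable_circleVolume (hkc.mul hmc))
          (ae_of_all _ fun s =>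
            mul_nonneg (poissonDensity_nonneg hr hrR.le t s) (le_max_right _ _))
    _ = _ := by
        refine lintegral_congr fun s => ?_
        rw [ENNReal.ofReal_mul (poissonDensity_nonneg hr hrR.le t s), hm, ENNReal.ofReal_max,
          ENNReal.ofReal_zero, max_eq_left zero_le]

/-- The means `∫ (|g| - l)⁺` over circles increase with the radius. -/
lemma lintegral_norm_sub_mono {g : ℂ → ℂ} {r R : ℝ} (hr : 0 ≤ r) (hrR : r < R)
    (hg : DiffContOnCl ℂ g (Metric.ball 0 R)) (l : ℝ) :
    ∫⁻ t, ENNReal.ofReal (‖g (circleMap 0 r t)‖ - l) ∂circleVolume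
      ≤ ∫⁻ s, ENNReal.ofReal (‖g (circleMap 0 R s)‖ - l) ∂circleVolume := by
  have hR : 0 < R := hr.trans_lt hrR
  have hgc : Continuous fun s => g (circleMap 0 R s) :=
    hg.continuousOn.comp_continuous (by fun_prop) fun s => by
      rw [closure_ball _ hR.ne', mem_closedBall_zero_iff, norm_circleMap_zero, abs_of_pos hR]
  have hmeas : Measurable fun s => ENNReal.ofReal (‖g (circleMap 0 R s)‖ - l) :=
    (hgc.norm.sub continuous_const).measurable.ennreal_ofReal
  refine (lintegral_mono fun t => ofReal_norm_sub_le_lintegral hr hrR hg hgc l t).trans ?_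
  rw [lintegral_lintegral_swap ((continuous_poissonDensity hr hrR).measurable.ennreal_ofReal.mul
    (hmeas.comp measurable_snd)).aemeasurable]
  refine le_of_eq (lintegral_congr fun s => ?_)
  rw [lintegral_mul_const' _ _ ENNReal.ofReal_ne_top, lintegral_poissonDensity_left hr hrR,
    one_mul]

/-- The K-functional of `|g|` on a circle increases with the radius. It is the infimum over `l` of
`s l + ∫ (|g| - l)⁺`, and these increase because `(|g| - l)⁺` is subharmonic. -/
lemma kFunctional_circleMap_mono {g : ℂ → ℂ} {r R : ℝ} (hr : 0 ≤ r) (hrR : r < R)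
    (hg : DiffContOnCl ℂ g (Metric.ball 0 R)) (s : ℝ≥0∞) :
    kFunctional circleVolume s (fun t => ‖g (circleMap 0 r t)‖)
      ≤ kFunctional circleVolume s (fun t => ‖g (circleMap 0 R t)‖) := by
  rcases eq_or_ne s 0 with rfl | hs
  · simp
  have hR : 0 < R := hr.trans_lt hrR
  have hm : ∀ ρ ∈ Icc 0 R, AEMeasurable (fun t => ‖g (circleMap 0 ρ t)‖) circleVolume := by
    intro ρ hρ
    refine (Continuous.norm (hg.continuousOn.comp_continuous (by fun_prop)
      fun s => ?_)).measurable.aemeasurable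
    rw [closure_ball _ hR.ne', mem_closedBall_zero_iff, norm_circleMap_zero, abs_of_nonneg hρ.1]
    exact hρ.2
  obtain ⟨l, hl, h⟩ := exists_kFunctional_eq hs (hm R ⟨hR.le, le_rfl⟩)
  rw [h]
  exact (kFunctional_le (hm r ⟨hr, hrR.le⟩) hl).trans
    (add_le_add_right (lintegral_norm_sub_mono hr hrR hg l) _)

end Circle

/-! ### Parseval's identity on the circle -/

section Parseval

lemma integral_cexp_int (n : ℤ) :
    ∫ t, Complex.exp (n * t * Complex.I) ∂circleVolume = if n = 0 then 2 * Real.pi else 0 := by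
  rw [integral_circleVolume]
  split_ifs with h
  · simp [h]
  · have hc : (n : ℂ) * Complex.I ≠ 0 := by simp [h, Complex.I_ne_zero]
    have e : ∀ t : ℝ, Complex.exp (n * t * Complex.I) = Complex.exp (n * Complex.I * t) :=
      fun t => by congr 1; ring
    simp_rw [e]
    rw [integral_exp_mul_complex hc]
    have : Complex.exp (n * Complex.I * (2 * Real.pi : ℝ)) = 1 := by
      rw [Complex.exp_eq_one_iff]
      exact ⟨n, by push_cast; ring⟩
    rw [this]; simp

/-- Parseval's identity for absolutely convergent power series on the unit circle. -/
lemma integral_norm_sq_tsum {b : ℕ → ℂ} (hb : Summable fun k => ‖b k‖) :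
    ∫ t, ‖∑' k, b k * Complex.exp (k * t * Complex.I)‖ ^ 2 ∂circleVolume
      = 2 * Real.pi * ∑' k, ‖b k‖ ^ 2 := by
  set e : ℕ → ℝ → ℂ := fun k t => Complex.exp (k * t * Complex.I) with he
  have hnorm : ∀ k t, ‖e k t‖ = 1 := fun k t => by
    have : (k : ℂ) * t * Complex.I = ((k * t : ℝ) : ℂ) * Complex.I := by push_cast; ring
    simp only [he, this, Complex.norm_exp_ofReal_mul_I]
  have hec : ∀ k, Continuous (e k) := fun k => by fun_prop
  set S : ℝ → ℂ := fun t => ∑' k, b k * e k t with hS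
  have hSc : Continuous S := continuous_tsum (fun k => (hec k).const_mul _) hb
    (fun k t => by rw [norm_mul, hnorm, mul_one])
  have hint : ∀ {F : ℝ → ℂ}, Continuous F → Integrable F circleVolume := integrable_circleVolume
  -- Integration of the series against a continuous function.
  have hswap : ∀ {w : ℝ → ℂ}, Continuous w → (∃ M, ∀ t, ‖w t‖ ≤ M) →
      ∫ t, S t * w t ∂circleVolume = ∑' k, b k * ∫ t, e k t * w t ∂circleVolume := by
    rintro w hw ⟨M, hM⟩
    have hM0 : 0 ≤ M := (norm_nonneg _).trans (hM 0)
    have h1 : ∀ t, S t * w t = ∑' k, b k * (e k t * w t) := fun t => by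
      rw [hS]; simp only; rw [← tsum_mul_right]; simp_rw [mul_assoc]
    simp_rw [h1]
    rw [← integral_tsum_of_summable_integral_norm]
    · simp_rw [integral_const_mul]
    · exact fun k => hint (((hec k).mul hw).const_mul _)
    · refine Summable.of_nonneg_of_le (fun k => integral_nonneg fun t => norm_nonneg _)
        (fun k => ?_) (hb.mul_right (M * circleVolume.real univ))
      have : ∀ t, ‖b k * (e k t * w t)‖ ≤ ‖b k‖ * M := fun t => by
        rw [norm_mul, norm_mul, hnorm, one_mul]
        exact mul_le_mul_of_nonneg_left (hM t) (norm_nonneg _)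
      refine (integral_mono (hint (((hec k).mul hw).const_mul _)).norm (integrable_const _)
        this).trans (le_of_eq ?_)
      rw [integral_const, smul_eq_mul]; ring
  have hconj : ∀ k t, (starRingEnd ℂ) (e k t) = Complex.exp (-(k * t * Complex.I)) := by
    intro k t
    simp only [he, ← Complex.exp_conj, map_mul, Complex.conj_I, Complex.conj_ofReal,
      map_natCast, mul_neg]
  have hprod : ∀ j k, ∫ t, e k t * (starRingEnd ℂ) (e j t) ∂circleVolume
      = if k = j then 2 * Real.pi else 0 := by
    intro j k
    have h := integral_cexp_int ((k : ℤ) - j)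
    simp only [sub_eq_zero, Nat.cast_inj] at h
    rw [← h]
    refine integral_congr_ae (ae_of_all _ fun t => ?_)
    simp only [hconj]
    rw [he, ← Complex.exp_add]
    congr 1; push_cast; ring
  have hcoef : ∀ j, ∫ t, S t * (starRingEnd ℂ) (e j t) ∂circleVolume = 2 * Real.pi * b j := by
    intro j
    rw [hswap (w := fun t => (starRingEnd ℂ) (e j t)) (Complex.continuous_conj.comp (hec j))
      ⟨1, fun t => by simp [hnorm]⟩]
    simp_rw [hprod]
    rw [tsum_eq_single j fun k hk => by simp [hk]]
    simp [mul_comm]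
  have hcoef' : ∀ j, ∫ t, e j t * (starRingEnd ℂ) (S t) ∂circleVolume
      = 2 * Real.pi * (starRingEnd ℂ) (b j) := by
    intro j
    have := congrArg (starRingEnd ℂ) (hcoef j)
    rw [← integral_conj] at this
    simp only [map_mul, Complex.conj_conj, Complex.conj_ofReal, map_ofNat] at this
    simp_rw [← this, mul_comm]
  have hSb : ∃ M, ∀ t, ‖(starRingEnd ℂ) (S t)‖ ≤ M := ⟨∑' k, ‖b k‖, fun t => by
    rw [RCLike.norm_conj]
    refine (norm_tsum_le_tsum_norm ?_).trans (le_of_eq ?_)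
    · simpa [hnorm] using hb
    · simp [hnorm]⟩
  have hmain := hswap (Complex.continuous_conj.comp hSc) hSb
  simp only [Function.comp_apply] at hmain
  simp_rw [hcoef'] at hmain
  have h1 : ∀ t, S t * (starRingEnd ℂ) (S t) = ((‖S t‖ ^ 2 : ℝ) : ℂ) := fun t => by
    rw [Complex.mul_conj, Complex.normSq_eq_norm_sq]
  have h2 : ∀ k, b k * (2 * Real.pi * (starRingEnd ℂ) (b k))
      = ((2 * Real.pi * ‖b k‖ ^ 2 : ℝ) : ℂ) := fun k => by
    rw [mul_left_comm, Complex.mul_conj, Complex.normSq_eq_norm_sq]; push_cast; ring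
  simp_rw [h1, h2] at hmain
  rw [integral_complex_ofReal, ← Complex.ofReal_tsum, tsum_mul_left] at hmain
  exact Complex.ofReal_injective hmain

end Parseval

/-! ### Factorisation of polynomials into functions with dominated squares -/

section PolynomialFactorization

/-- `p` is on the unit disc a product `G * H` of two holomorphic functions whose squares are
dominated by a continuous function `q` that has the modulus of `p` on the unit circle. -/
def IsSquareFactorable (p : ℂ → ℂ) : Prop :=
  ∃ G H q : ℂ → ℂ, DifferentiableOn ℂ G (Metric.ball 0 1) ∧ DifferentiableOn ℂ H (Metric.ball 0 1) ∧
    Continuous q ∧ (∀ z ∈ Metric.ball (0 : ℂ) 1, G z * H z = p z) ∧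
    (∀ z ∈ Metric.ball (0 : ℂ) 1, ‖G z‖ ^ 2 ≤ ‖q z‖ ∧ ‖H z‖ ^ 2 ≤ ‖q z‖) ∧
    ∀ z ∈ Metric.sphere (0 : ℂ) 1, ‖q z‖ = ‖p z‖

lemma IsSquareFactorable.mul {p₁ p₂ : ℂ → ℂ} (h₁ : IsSquareFactorable p₁)
    (h₂ : IsSquareFactorable p₂) : IsSquareFactorable fun z => p₁ z * p₂ z := by
  obtain ⟨G₁, H₁, q₁, hG₁, hH₁, hq₁, hp₁, hb₁, hs₁⟩ := h₁
  obtain ⟨G₂, H₂, q₂, hG₂, hH₂, hq₂, hp₂, hb₂, hs₂⟩ := h₂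
  refine ⟨fun z => G₁ z * G₂ z, fun z => H₁ z * H₂ z, fun z => q₁ z * q₂ z, hG₁.mul hG₂,
    hH₁.mul hH₂, hq₁.mul hq₂, fun z hz => ?_, fun z hz => ⟨?_, ?_⟩, fun z hz => ?_⟩
  · simp only [← hp₁ z hz, ← hp₂ z hz]; ring
  · rw [norm_mul, norm_mul, mul_pow]
    exact mul_le_mul (hb₁ z hz).1 (hb₂ z hz).1 (by positivity) (by positivity)
  · rw [norm_mul, norm_mul, mul_pow]
    exact mul_le_mul (hb₁ z hz).2 (hb₂ z hz).2 (by positivity) (by positivity)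
  · rw [norm_mul, norm_mul, hs₁ z hz, hs₂ z hz]

lemma exists_sq_eq (c : ℂ) : ∃ w : ℂ, w * w = c :=
  (IsAlgClosed.exists_eq_mul_self c).imp fun _ h => h.symm

lemma isSquareFactorable_const (c : ℂ) : IsSquareFactorable fun _ => c := by
  obtain ⟨w, hw⟩ := exists_sq_eq c
  have : ‖w‖ ^ 2 = ‖c‖ := by rw [← hw, norm_mul, sq]
  exact ⟨fun _ => w, fun _ => w, fun _ => c, differentiableOn_const _, differentiableOn_const _,
    continuous_const, fun _ _ => hw, fun _ _ => ⟨this.le, this.le⟩, fun _ _ => rfl⟩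

/-- For `‖b‖ ≤ 1` the function `1 - b z` has a holomorphic square root in the unit disc, as it takes
values in the right half-plane. -/
lemma exists_sqrt_one_sub_mul {b : ℂ} (hb : ‖b‖ ≤ 1) :
    ∃ G : ℂ → ℂ, DifferentiableOn ℂ G (Metric.ball 0 1) ∧
      (∀ z ∈ Metric.ball (0 : ℂ) 1, G z * G z = 1 - b * z) ∧
      ∀ z ∈ Metric.ball (0 : ℂ) 1, G z ≠ 0 := by
  have hre : ∀ z ∈ Metric.ball (0 : ℂ) 1, 0 < (1 - b * z).re := by
    intro z hz
    rw [mem_ball_zero_iff] at hz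
    have h1 : ‖b * z‖ < 1 := by
      rw [norm_mul]
      nlinarith [norm_nonneg z, norm_nonneg b]
    have := Complex.re_le_norm (b * z)
    simp only [Complex.sub_re, Complex.one_re]
    linarith
  have hsq : ∀ z ∈ Metric.ball (0 : ℂ) 1,
      (1 - b * z) ^ ((2 : ℕ) : ℂ)⁻¹ * (1 - b * z) ^ ((2 : ℕ) : ℂ)⁻¹ = 1 - b * z := by
    intro z _
    rw [← sq, Complex.cpow_nat_inv_pow _ two_ne_zero]
  refine ⟨fun z => (1 - b * z) ^ ((2 : ℕ) : ℂ)⁻¹, ?_, hsq, fun z hz h0 => ?_⟩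
  · exact DifferentiableOn.cpow (by fun_prop) (differentiableOn_const _)
      fun z hz => Or.inl (hre z hz)
  · have := hsq z hz
    simp only at h0
    rw [h0, mul_zero] at this
    have h2 := hre z hz
    rw [← this] at h2
    simp at h2

/-- For `|a| < 1` the factor `1 - ā z` has no zero in the disc and the modulus of `z - a` on the circle;
one puts `G = √(1 - ā z)` and `H = (z - a) / G`. For `|a| ≥ 1` the factor itself has a square root. -/
lemma isSquareFactorable_sub_const (a : ℂ) : IsSquareFactorable fun z => z - a := by
  rcases lt_or_ge ‖a‖ 1 with ha | ha
  · obtain ⟨G, hG, hGs, hG0⟩ := exists_sqrt_one_sub_mul (b := (starRingEnd ℂ) a)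
      (by rw [RCLike.norm_conj]; exact ha.le)
    have hid : ∀ z : ℂ, ‖1 - (starRingEnd ℂ) a * z‖ ^ 2 - ‖z - a‖ ^ 2
        = (1 - ‖a‖ ^ 2) * (1 - ‖z‖ ^ 2) := by
      intro z
      simp only [← Complex.normSq_eq_norm_sq, Complex.normSq_apply, Complex.sub_re, Complex.sub_im,
        Complex.mul_re, Complex.mul_im, Complex.conj_re, Complex.conj_im, Complex.one_re,
        Complex.one_im]
      ring
    have hGn : ∀ z ∈ Metric.ball (0 : ℂ) 1, ‖G z‖ ^ 2 = ‖1 - (starRingEnd ℂ) a * z‖ :=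
      fun z hz => by rw [← hGs z hz, norm_mul, sq]
    refine ⟨G, fun z => (z - a) / G z, fun z => 1 - (starRingEnd ℂ) a * z, hG,
      DifferentiableOn.div (by fun_prop) hG hG0, by fun_prop,
      fun z hz => mul_div_cancel₀ _ (hG0 z hz), fun z hz => ⟨(hGn z hz).le, ?_⟩, fun z hz => ?_⟩
    · have hz' : ‖z‖ < 1 := by simpa using hz
      have h1 : ‖z - a‖ ^ 2 ≤ ‖1 - (starRingEnd ℂ) a * z‖ ^ 2 := by
        have h2 := hid z
        have h3 : 0 ≤ (1 - ‖a‖ ^ 2) * (1 - ‖z‖ ^ 2) :=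
          mul_nonneg (by nlinarith [norm_nonneg a]) (by nlinarith [norm_nonneg z])
        linarith
      have hpos : 0 < ‖1 - (starRingEnd ℂ) a * z‖ := by
        rw [← hGn z hz]
        have := norm_pos_iff.2 (hG0 z hz)
        positivity
      rw [norm_div, div_pow, hGn z hz, div_le_iff₀ hpos, ← sq]
      exact h1
    · have hz' : ‖z‖ = 1 := by simpa using hz
      have h2 := hid z
      rw [hz'] at h2
      exact (sq_eq_sq₀ (norm_nonneg _) (norm_nonneg _)).1 (by linarith)
  · have ha0 : a ≠ 0 := fun h => by simp [h] at ha; linarith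
    obtain ⟨G, hG, hGs, -⟩ := exists_sqrt_one_sub_mul (b := a⁻¹)
      (by rw [norm_inv]; exact inv_le_one_of_one_le₀ ha)
    have hfac : IsSquareFactorable fun z => 1 - a⁻¹ * z := by
      have hn : ∀ z ∈ Metric.ball (0 : ℂ) 1, ‖G z‖ ^ 2 ≤ ‖1 - a⁻¹ * z‖ := fun z hz => by
        rw [← hGs z hz, norm_mul, sq]
      exact ⟨G, G, fun z => 1 - a⁻¹ * z, hG, hG, by fun_prop, hGs,
        fun z hz => ⟨hn z hz, hn z hz⟩, fun _ _ => rfl⟩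
    convert (isSquareFactorable_const (-a)).mul hfac using 2 with z
    field_simp
    ring

lemma isSquareFactorable_polynomial (p : Polynomial ℂ) : IsSquareFactorable fun z => p.eval z := by
  rw [(IsAlgClosed.splits p).eq_prod_roots]
  have h : IsSquareFactorable fun z =>
      ((p.roots.map fun a => Polynomial.X - Polynomial.C a).prod).eval z := by
    refine Multiset.prod_induction (fun r : Polynomial ℂ => IsSquareFactorable fun z => r.eval z) _
      (fun r s hr hs => ?_) ?_ fun r hr => ?_
    · simpa using hr.mul hs
    · simpa using isSquareFactorable_const 1
    · obtain ⟨a, -, rfl⟩ := Multiset.mem_map.1 hr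
      simpa using isSquareFactorable_sub_const a
  simpa using (isSquareFactorable_const p.leadingCoeff).mul h

end PolynomialFactorization

/-! ### Taylor coefficients -/

section TaylorCoefficients

/-- The `k`-th Taylor coefficient of `g` at `0`. -/
def taylorCoeff (g : ℂ → ℂ) (k : ℕ) : ℂ := (k.factorial : ℂ)⁻¹ * iteratedDeriv k g 0

lemma hasSum_taylorCoeff {g : ℂ → ℂ} (hg : DifferentiableOn ℂ g (Metric.ball 0 1)) {z : ℂ}
    (hz : ‖z‖ < 1) : HasSum (fun k => taylorCoeff g k * z ^ k) (g z) := by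
  have := Complex.hasSum_taylorSeries_on_ball hg (mem_ball_zero_iff.2 hz)
  simp only [sub_zero, smul_eq_mul] at this
  have e : (fun k => taylorCoeff g k * z ^ k)
      = fun k => (k.factorial : ℂ)⁻¹ * (z ^ k * iteratedDeriv k g 0) := by
    ext k
    rw [taylorCoeff]; ring
  rwa [e]

lemma summable_norm_taylorCoeff {g : ℂ → ℂ} (hg : DifferentiableOn ℂ g (Metric.ball 0 1)) {r : ℝ}
    (hr : 0 ≤ r) (hr1 : r < 1) : Summable fun k => ‖taylorCoeff g k‖ * r ^ k := by
  have hz : ‖(r : ℂ)‖ < 1 := by rwa [Complex.norm_real, Real.norm_of_nonneg hr]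
  have := (hasSum_taylorCoeff hg hz).summable.norm
  simpa [norm_mul, norm_pow, abs_of_nonneg hr] using this

lemma taylorCoeff_mul {G H p : ℂ → ℂ} (hG : DifferentiableOn ℂ G (Metric.ball 0 1))
    (hH : DifferentiableOn ℂ H (Metric.ball 0 1))
    (hp : ∀ z ∈ Metric.ball (0 : ℂ) 1, G z * H z = p z) (k : ℕ) :
    taylorCoeff p k = ∑ ij ∈ Finset.HasAntidiagonal.antidiagonal k, taylorCoeff G ij.1 * taylorCoeff H ij.2 := by
  have h0 : Metric.ball (0 : ℂ) 1 ∈ 𝓝 (0 : ℂ) := Metric.ball_mem_nhds _ one_pos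
  have he : p =ᶠ[𝓝 0] G * H := by
    filter_upwards [h0] with z hz using (hp z hz).symm
  simp only [taylorCoeff]
  rw [he.iteratedDeriv_eq, iteratedDeriv_mul (hG.analyticAt h0).contDiffAt
    (hH.analyticAt h0).contDiffAt, Finset.mul_sum,
    Finset.Nat.sum_antidiagonal_eq_sum_range_succ_mk]
  refine Finset.sum_congr rfl fun i hi => ?_
  rw [Nat.cast_choose _ (by grind)]
  field_simp [Nat.factorial_ne_zero]

lemma taylorCoeff_polynomial (p : Polynomial ℂ) (k : ℕ) :
    taylorCoeff (fun z => p.eval z) k = p.coeff k := by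
  have h : ∀ n : ℕ, iteratedDeriv n (fun z => p.eval z)
      = fun z => ((Polynomial.derivative)^[n] p).eval z := by
    intro n
    induction n with
    | zero => simp
    | succ n ih =>
      rw [iteratedDeriv_succ, ih, Function.iterate_succ_apply']
      ext z; simp
  rw [taylorCoeff, h]
  simp only
  rw [← Polynomial.coeff_zero_eq_eval_zero, Polynomial.coeff_iterate_derivative,
    zero_add, Nat.descFactorial_self, nsmul_eq_mul, inv_mul_cancel_left₀]
  exact_mod_cast k.factorial_ne_zero

lemma tsum_circleMap {c : ℕ → ℂ} (r t : ℝ) :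
    ∑' k, c k * (circleMap 0 r t) ^ k
      = ∑' k, (c k * (r : ℂ) ^ k) * Complex.exp (k * t * Complex.I) := by
  refine tsum_congr fun k => ?_
  rw [circleMap_zero, mul_pow, ← Complex.exp_nat_mul]
  ring_nf

/-- Parseval's identity on circles. -/
lemma integral_norm_sq_circleMap {c : ℕ → ℂ} {r : ℝ} (hr : 0 ≤ r)
    (hc : Summable fun k => ‖c k‖ * r ^ k) :
    ∫ t, ‖∑' k, c k * (circleMap 0 r t) ^ k‖ ^ 2 ∂circleVolume
      = 2 * Real.pi * ∑' k, (‖c k‖ * r ^ k) ^ 2 := by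
  simp_rw [tsum_circleMap]
  have e : ∀ k, ‖c k * (r : ℂ) ^ k‖ = ‖c k‖ * r ^ k := fun k => by
    simp [abs_of_nonneg hr]
  rw [integral_norm_sq_tsum (by simpa only [e] using hc)]
  simp_rw [e]

/-- Parseval's identity on circles of radius `r < 1`, in the limit `r → 1`. -/
lemma sum_sq_taylorCoeff_le {G q : ℂ → ℂ} (hG : DifferentiableOn ℂ G (Metric.ball 0 1))
    (hq : Continuous q) (hGq : ∀ z ∈ Metric.ball (0 : ℂ) 1, ‖G z‖ ^ 2 ≤ ‖q z‖) (K : ℕ) :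
    2 * Real.pi * ∑ k ∈ Finset.range K, ‖taylorCoeff G k‖ ^ 2
      ≤ ∫ t, ‖q (circleMap 0 1 t)‖ ∂circleVolume := by
  have hr : ∀ r ∈ Ioo (0 : ℝ) 1,
      2 * Real.pi * ∑ k ∈ Finset.range K, (‖taylorCoeff G k‖ * r ^ k) ^ 2
        ≤ ∫ t, ‖q (circleMap 0 r t)‖ ∂circleVolume := by
    intro r hr
    have hs := summable_norm_taylorCoeff hG hr.1.le hr.2
    have hmem : ∀ t, circleMap 0 r t ∈ Metric.ball (0 : ℂ) 1 := fun t => by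
      rw [mem_ball_zero_iff, norm_circleMap_zero, abs_of_pos hr.1]; exact hr.2
    have hGt : ∀ t, ∑' k, taylorCoeff G k * (circleMap 0 r t) ^ k = G (circleMap 0 r t) := fun t =>
      (hasSum_taylorCoeff hG (mem_ball_zero_iff.1 (hmem t))).tsum_eq
    have hP := integral_norm_sq_circleMap hr.1.le hs
    simp_rw [hGt] at hP
    have hs2 : Summable fun k => (‖taylorCoeff G k‖ * r ^ k) ^ 2 :=
      Summable.of_norm_bounded_eventually_nat hs (by
        filter_upwards [hs.tendsto_atTop_zero.eventually (Iio_mem_nhds one_pos)] with k hk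
        have h0 : 0 ≤ ‖taylorCoeff G k‖ * r ^ k := mul_nonneg (norm_nonneg _) (pow_nonneg hr.1.le _)
        rw [Real.norm_of_nonneg (sq_nonneg _)]
        have : ‖taylorCoeff G k‖ * r ^ k < 1 := hk
        nlinarith)
    calc _ ≤ 2 * Real.pi * ∑' k, (‖taylorCoeff G k‖ * r ^ k) ^ 2 := by
          gcongr
          exact hs2.sum_le_tsum _ fun k _ => sq_nonneg _
      _ = _ := hP.symm
      _ ≤ _ := by
          refine integral_mono (integrable_circleVolume ?_) (integrable_circleVolume
            ((hq.comp (by fun_prop)).norm)) fun t => hGq _ (hmem t)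
          exact (hG.continuousOn.comp_continuous (by fun_prop) hmem).norm.pow 2
  have h1 : Tendsto (fun r : ℝ => 2 * Real.pi *
      ∑ k ∈ Finset.range K, (‖taylorCoeff G k‖ * r ^ k) ^ 2) (𝓝[<] 1)
      (𝓝 (2 * Real.pi * ∑ k ∈ Finset.range K, ‖taylorCoeff G k‖ ^ 2)) := by
    have hc : Continuous fun r : ℝ => 2 * Real.pi *
      ∑ k ∈ Finset.range K, (‖taylorCoeff G k‖ * r ^ k) ^ 2 := by fun_prop
    have := hc.tendsto 1
    simp only [one_pow, mul_one] at this
    exact this.mono_left nhdsWithin_le_nhds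
  have h2 : Tendsto (fun r : ℝ => ∫ t, ‖q (circleMap 0 r t)‖ ∂circleVolume) (𝓝[<] 1)
      (𝓝 (∫ t, ‖q (circleMap 0 1 t)‖ ∂circleVolume)) := by
    simp_rw [integral_circleVolume]
    have hc : Continuous fun r : ℝ => ∫ t in 0..2 * Real.pi, ‖q (circleMap 0 r t)‖ := by
      refine intervalIntegral.continuous_parametric_intervalIntegral_of_continuous' ?_ _ _
      refine (hq.comp ?_).norm
      simp only [circleMap_zero]
      fun_prop
    exact (hc.tendsto 1).mono_left nhdsWithin_le_nhds
  refine le_of_tendsto_of_tendsto h1 h2 ?_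
  filter_upwards [Ioo_mem_nhdsLT (zero_lt_one' ℝ)] with r hr' using hr r hr'

end TaylorCoefficients

/-! ### Riesz factorisation of `H¹` functions -/

section HardySpace

/-- The radii `1 - 1 / (n + 1)`, a sequence increasing to `1`. -/
def radius (n : ℕ) : ℝ := 1 - 1 / ((n : ℝ) + 1)

lemma radius_mem (n : ℕ) : radius n ∈ Ico (0 : ℝ) 1 := by
  have h : (0 : ℝ) < (n : ℝ) + 1 := by positivity
  refine ⟨?_, ?_⟩
  · rw [radius, sub_nonneg, div_le_one h]; linarith [Nat.cast_nonneg (α := ℝ) n]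
  · have : 0 < 1 / ((n : ℝ) + 1) := by positivity
    rw [radius]; linarith

lemma tendsto_radius : Tendsto radius atTop (𝓝 1) := by
  have := (tendsto_one_div_add_atTop_nhds_zero_nat (𝕜 := ℝ)).const_sub 1
  rw [sub_zero] at this
  exact this

lemma circleMap_mem_ball {r : ℝ} (hr : r ∈ Ico (0 : ℝ) 1) (t : ℝ) :
    circleMap 0 r t ∈ Metric.ball (0 : ℂ) 1 := by
  rw [mem_ball_zero_iff, norm_circleMap_zero, abs_of_nonneg hr.1]; exact hr.2

lemma continuous_comp_circleMap {g : ℂ → ℂ} (hg : DifferentiableOn ℂ g (Metric.ball 0 1)) {r : ℝ}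
    (hr : r ∈ Ico (0 : ℝ) 1) : Continuous fun t => g (circleMap 0 r t) :=
  hg.continuousOn.comp_continuous (by fun_prop) (circleMap_mem_ball hr)

/-- Taylor polynomials of the dilations of `g` have nearly the same integral means as `g`. -/
lemma exists_polynomial_coeff_eq {g : ℂ → ℂ} (hg : DifferentiableOn ℂ g (Metric.ball 0 1))
    {R : ℝ} (hR : R ∈ Ico (0 : ℝ) 1) (n : ℕ) :
    ∃ p : Polynomial ℂ, (∀ k < n, p.coeff k = taylorCoeff g k * (R : ℂ) ^ k) ∧
      ∫ t, ‖p.eval (circleMap 0 1 t)‖ ∂circleVolume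
        ≤ (∫ t, ‖g (circleMap 0 R t)‖ ∂circleVolume) + 2 * Real.pi := by
  set c := taylorCoeff g with hc
  have hs := summable_norm_taylorCoeff hg hR.1 hR.2
  have htail := tendsto_sum_nat_add fun k => ‖c k‖ * R ^ k
  obtain ⟨N, hN1, hNn⟩ := ((htail.eventually (Iio_mem_nhds one_pos)).and
    (eventually_ge_atTop n)).exists
  refine ⟨∑ k ∈ Finset.range N, Polynomial.C (c k * (R : ℂ) ^ k) * Polynomial.X ^ k, ?_, ?_⟩
  · intro k hk
    simp only [Polynomial.finsetSum_coeff, Polynomial.coeff_C_mul_X_pow]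
    rw [Finset.sum_eq_single k]
    · simp
    · intro j _ hj; simp [hj.symm]
    · intro h; exact absurd (Finset.mem_range.2 (hk.trans_le hNn)) h
  · have hpt : ∀ t, ‖(∑ k ∈ Finset.range N,
        Polynomial.C (c k * (R : ℂ) ^ k) * Polynomial.X ^ k).eval (circleMap 0 1 t)‖
        ≤ ‖g (circleMap 0 R t)‖ + 1 := by
      intro t
      have hsum := hasSum_taylorCoeff hg (mem_ball_zero_iff.1 (circleMap_mem_ball hR t))
      have hsplit := hsum.summable.sum_add_tsum_nat_add N
      rw [hsum.tsum_eq] at hsplit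
      have heval : (∑ k ∈ Finset.range N,
          Polynomial.C (c k * (R : ℂ) ^ k) * Polynomial.X ^ k).eval (circleMap 0 1 t)
          = ∑ k ∈ Finset.range N, taylorCoeff g k * circleMap 0 R t ^ k := by
        simp only [Polynomial.eval_finsetSum, Polynomial.eval_mul, Polynomial.eval_C,
          Polynomial.eval_pow, Polynomial.eval_X, circleMap_zero, mul_pow, hc]
        refine Finset.sum_congr rfl fun k _ => ?_
        simp [mul_assoc]
      have hn : ∀ k, ‖taylorCoeff g (k + N) * circleMap 0 R t ^ (k + N)‖
          = ‖c (k + N)‖ * R ^ (k + N) := fun k => by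
        rw [norm_mul, norm_pow, norm_circleMap_zero, abs_of_nonneg hR.1]
      have htl : ‖∑' k, taylorCoeff g (k + N) * circleMap 0 R t ^ (k + N)‖ ≤ 1 := by
        refine (norm_tsum_le_tsum_norm ?_).trans ?_
        · simp_rw [hn]; exact (summable_nat_add_iff N).2 hs
        · simp_rw [hn]; exact le_of_lt hN1
      rw [heval, eq_sub_of_add_eq hsplit]
      exact (norm_sub_le _ _).trans (by linarith)
    have hgi := integrable_circleVolume (continuous_comp_circleMap hg hR).norm
    calc _ ≤ ∫ t, (‖g (circleMap 0 R t)‖ + 1) ∂circleVolume := by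
          refine integral_mono (integrable_circleVolume ?_) (hgi.add (integrable_const _)) hpt
          exact ((Polynomial.continuous _).comp (by fun_prop)).norm
      _ ≤ _ := by
          rw [integral_add hgi (integrable_const _), integral_const, smul_eq_mul, mul_one]
          exact add_le_add_right circleVolume_real_univ_le _

/-- Along an ultrafilter, sequences bounded in `ℓ²` have coordinatewise limits in `ℓ²`. -/
lemma exists_ultrafilter_limit_sq_summable (U : Ultrafilter ℕ) {a : ℕ → ℕ → ℂ} {M : ℝ}
    (h : ∀ n K, ∑ k ∈ Finset.range K, ‖a n k‖ ^ 2 ≤ M) :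
    ∃ b : ℕ → ℂ, Summable (fun k => ‖b k‖ ^ 2) ∧
      ∀ k, Tendsto (fun n => a n k) U (𝓝 (b k)) := by
  have hb : ∀ k, ∃ x : ℂ, Tendsto (fun n => a n k) U (𝓝 x) := by
    intro k
    obtain ⟨x, -, hx⟩ := (isCompact_closedBall (0 : ℂ) (√M)).ultrafilter_le_nhds
      (U.map fun n => a n k) (by
        rw [Ultrafilter.coe_map, le_principal_iff]
        refine Eventually.of_forall (f := (U : Filter ℕ)) (p := fun n => a n k ∈ _) fun n => ?_
        rw [mem_closedBall_zero_iff]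
        refine Real.le_sqrt_of_sq_le ((Finset.single_le_sum (f := fun k => ‖a n k‖ ^ 2)
          (fun i _ => sq_nonneg _) (Finset.self_mem_range_succ k)).trans (h n (k + 1))))
    exact ⟨x, hx⟩
  choose b hb using hb
  refine ⟨b, summable_of_sum_range_le (c := M) (fun k => sq_nonneg _) fun K => ?_, hb⟩
  exact le_of_tendsto' (tendsto_finsetSum _ fun k _ => ((hb k).norm.pow 2)) fun n => h n K

/-- The Riesz factorisation `H¹ = H² · H²`, on the level of Taylor coefficients. -/
lemma exists_sq_summable_factorization {g : ℂ → ℂ} (hg : DifferentiableOn ℂ g (Metric.ball 0 1))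
    {C : ℝ} (hC : ∀ r ∈ Ico (0 : ℝ) 1, ∫ t, ‖g (circleMap 0 r t)‖ ∂circleVolume ≤ C) :
    ∃ a b : ℕ → ℂ, Summable (fun k => ‖a k‖ ^ 2) ∧ Summable (fun k => ‖b k‖ ^ 2) ∧
      ∀ k, taylorCoeff g k = ∑ ij ∈ Finset.HasAntidiagonal.antidiagonal k, a ij.1 * b ij.2 := by
  have hn : ∀ n : ℕ, ∃ a b : ℕ → ℂ,
      (∀ K, ∑ k ∈ Finset.range K, ‖a k‖ ^ 2 ≤ (C + 2 * Real.pi) / (2 * Real.pi)) ∧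
      (∀ K, ∑ k ∈ Finset.range K, ‖b k‖ ^ 2 ≤ (C + 2 * Real.pi) / (2 * Real.pi)) ∧
      ∀ k < n, taylorCoeff g k * (radius n : ℂ) ^ k
        = ∑ ij ∈ Finset.HasAntidiagonal.antidiagonal k, a ij.1 * b ij.2 := by
    intro n
    obtain ⟨p, hpc, hpi⟩ := exists_polynomial_coeff_eq hg (radius_mem n) n
    obtain ⟨G, H, q, hG, hH, hq, hGH, hle, hqp⟩ := isSquareFactorable_polynomial p
    have hqi : ∫ t, ‖q (circleMap 0 1 t)‖ ∂circleVolume ≤ C + 2 * Real.pi := by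
      have : ∀ t, ‖q (circleMap 0 1 t)‖ = ‖p.eval (circleMap 0 1 t)‖ := fun t =>
        hqp _ (by simp)
      simp_rw [this]
      linarith [hC _ (radius_mem n)]
    refine ⟨taylorCoeff G, taylorCoeff H, fun K => ?_, fun K => ?_, fun k hk => ?_⟩
    · rw [le_div_iff₀' (by positivity)]
      exact (sum_sq_taylorCoeff_le hG hq (fun z hz => (hle z hz).1) K).trans hqi
    · rw [le_div_iff₀' (by positivity)]
      exact (sum_sq_taylorCoeff_le hH hq (fun z hz => (hle z hz).2) K).trans hqi
    · rw [← taylorCoeff_mul hG hH hGH, taylorCoeff_polynomial, hpc k hk]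
  choose a b ha hb hab using hn
  obtain ⟨a', ha's, ha'⟩ := exists_ultrafilter_limit_sq_summable (hyperfilter ℕ) ha
  obtain ⟨b', hb's, hb'⟩ := exists_ultrafilter_limit_sq_summable (hyperfilter ℕ) hb
  have hle : (hyperfilter ℕ : Filter ℕ) ≤ atTop := Nat.hyperfilter_le_atTop
  refine ⟨a', b', ha's, hb's, fun k => ?_⟩
  have h1 : Tendsto (fun n => taylorCoeff g k * (radius n : ℂ) ^ k) (hyperfilter ℕ)
      (𝓝 (taylorCoeff g k)) := by
    have : Tendsto (fun n => taylorCoeff g k * (radius n : ℂ) ^ k) atTop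
        (𝓝 (taylorCoeff g k * ((1 : ℝ) : ℂ) ^ k)) :=
      (((Complex.continuous_ofReal.tendsto 1).comp tendsto_radius).pow k).const_mul _
    simpa using this.mono_left hle
  have h2 : Tendsto (fun n => ∑ ij ∈ Finset.HasAntidiagonal.antidiagonal k, a n ij.1 * b n ij.2)
      (hyperfilter ℕ) (𝓝 (∑ ij ∈ Finset.HasAntidiagonal.antidiagonal k, a' ij.1 * b' ij.2)) :=
    tendsto_finsetSum _ fun ij _ => (ha' ij.1).mul (hb' ij.2)
  refine tendsto_nhds_unique (h1.congr' ?_) h2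
  exact ((eventually_gt_atTop k).filter_mono hle).mono fun n hn => hab n k hn

end HardySpace

/-! ### Boundary functions -/

section Boundary

lemma summable_norm_mul_pow_of_sq {a : ℕ → ℂ} (ha : Summable fun k => ‖a k‖ ^ 2) {r : ℝ}
    (hr : r ∈ Ico (0 : ℝ) 1) : Summable fun k => ‖a k‖ * r ^ k := by
  have hb : ∀ k, ‖a k‖ * r ^ k ≤ r ^ k + ‖a k‖ ^ 2 := by
    intro k
    have h0 : 0 ≤ r ^ k := pow_nonneg hr.1 _
    have h1 : r ^ k ≤ 1 := pow_le_one₀ hr.1 hr.2.le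
    nlinarith [sq_nonneg (‖a k‖ - r ^ k), norm_nonneg (a k)]
  exact Summable.of_nonneg_of_le (fun k => mul_nonneg (norm_nonneg _) (pow_nonneg hr.1 _)) hb
    ((summable_geometric_of_lt_one hr.1 hr.2).add ha)

/-- The power series `∑ a k z ^ k`. -/
def powerSum (a : ℕ → ℂ) (z : ℂ) : ℂ := ∑' k, a k * z ^ k

lemma continuous_powerSum_circleMap {a : ℕ → ℂ} (ha : Summable fun k => ‖a k‖ ^ 2) {r : ℝ}
    (hr : r ∈ Ico (0 : ℝ) 1) : Continuous fun t => powerSum a (circleMap 0 r t) := by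
  refine continuous_tsum (fun k => by fun_prop) (summable_norm_mul_pow_of_sq ha hr) fun k t => ?_
  rw [norm_mul, norm_pow, norm_circleMap_zero, abs_of_nonneg hr.1]

lemma eLpNorm_two_eq {u : ℝ → ℂ} (hu : Continuous u) :
    eLpNorm u 2 circleVolume = ENNReal.ofReal √(∫ t, ‖u t‖ ^ 2 ∂circleVolume) := by
  have hm : MemLp u 2 circleVolume := by
    rw [memLp_two_iff_integrable_sq_norm hu.aestronglyMeasurable]
    exact integrable_circleVolume (hu.norm.pow 2)
  rw [hm.eLpNorm_eq_integral_rpow_norm two_ne_zero (by simp), Real.sqrt_eq_rpow]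
  simp

lemma eLpNorm_two_powerSum {a : ℕ → ℂ} (ha : Summable fun k => ‖a k‖ ^ 2) {r : ℝ}
    (hr : r ∈ Ico (0 : ℝ) 1) :
    eLpNorm (fun t => powerSum a (circleMap 0 r t)) 2 circleVolume
      ≤ ENNReal.ofReal √(2 * Real.pi * ∑' k, ‖a k‖ ^ 2) := by
  rw [eLpNorm_two_eq (continuous_powerSum_circleMap ha hr)]
  unfold powerSum
  rw [integral_norm_sq_circleMap hr.1 (summable_norm_mul_pow_of_sq ha hr)]
  have hle : ∀ k, (‖a k‖ * r ^ k) ^ 2 ≤ ‖a k‖ ^ 2 := fun k => by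
    have h0 : 0 ≤ r ^ k := pow_nonneg hr.1 _
    have h1 : r ^ k ≤ 1 := pow_le_one₀ hr.1 hr.2.le
    gcongr
    nlinarith [norm_nonneg (a k)]
  refine ENNReal.ofReal_le_ofReal (Real.sqrt_le_sqrt (mul_le_mul_of_nonneg_left ?_ (by positivity)))
  exact (Summable.of_nonneg_of_le (fun _ => sq_nonneg _) hle ha).tsum_le_tsum hle ha

/-- The restrictions of an `H²` function to circles are Cauchy in `L²`. -/
lemma tendsto_eLpNorm_two_powerSum_sub {a : ℕ → ℂ} (ha : Summable fun k => ‖a k‖ ^ 2) :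
    Tendsto (fun n : ℕ × ℕ => eLpNorm (fun t => powerSum a (circleMap 0 (radius n.1) t)
      - powerSum a (circleMap 0 (radius n.2) t)) 2 circleVolume) atTop (𝓝 0) := by
  have heq : ∀ n : ℕ × ℕ, eLpNorm (fun t => powerSum a (circleMap 0 (radius n.1) t)
      - powerSum a (circleMap 0 (radius n.2) t)) 2 circleVolume
      = ENNReal.ofReal √(2 * Real.pi *
        ∑' k, (‖a k‖ * |radius n.1 ^ k - radius n.2 ^ k|) ^ 2) := by
    intro n
    have hcont : Continuous fun t => powerSum a (circleMap 0 (radius n.1) t)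
        - powerSum a (circleMap 0 (radius n.2) t) :=
      (continuous_powerSum_circleMap ha (radius_mem _)).sub
        (continuous_powerSum_circleMap ha (radius_mem _))
    rw [eLpNorm_two_eq hcont]
    have hs : ∀ m, Summable fun k => ‖a k‖ * radius m ^ k := fun m =>
      summable_norm_mul_pow_of_sq ha (radius_mem m)
    have hn : ∀ m k t, ‖(a k * (radius m : ℂ) ^ k) * Complex.exp (k * (t : ℝ) * Complex.I)‖
        = ‖a k‖ * radius m ^ k := fun m k t => by
      have : (k : ℂ) * t * Complex.I = ((k * t : ℝ) : ℂ) * Complex.I := by push_cast; ring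
      rw [norm_mul, this, Complex.norm_exp_ofReal_mul_I, norm_mul, norm_pow, Complex.norm_real,
        Real.norm_of_nonneg (radius_mem m).1, mul_one]
    have hd : ∀ t : ℝ, powerSum a (circleMap 0 (radius n.1) t)
        - powerSum a (circleMap 0 (radius n.2) t)
        = ∑' k, (a k * ((radius n.1 ^ k - radius n.2 ^ k : ℝ) : ℂ))
          * Complex.exp (k * t * Complex.I) := by
      intro t
      unfold powerSum
      rw [tsum_circleMap, tsum_circleMap, ← Summable.tsum_sub
        (Summable.of_norm (by simpa only [hn] using hs n.1))
        (Summable.of_norm (by simpa only [hn] using hs n.2))]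
      refine tsum_congr fun k => ?_
      push_cast; ring
    have hnorm : ∀ k, ‖a k * ((radius n.1 ^ k - radius n.2 ^ k : ℝ) : ℂ)‖
        = ‖a k‖ * |radius n.1 ^ k - radius n.2 ^ k| := fun k => by
      rw [norm_mul, Complex.norm_real, Real.norm_eq_abs]
    simp_rw [hd]
    rw [integral_norm_sq_tsum]
    · simp_rw [hnorm]
    · simp_rw [hnorm]
      refine Summable.of_nonneg_of_le (fun k => by positivity) (fun k => ?_)
        ((hs n.1).add (hs n.2))
      rw [← mul_add]
      refine mul_le_mul_of_nonneg_left ?_ (norm_nonneg _)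
      refine (abs_sub _ _).trans (le_of_eq ?_)
      rw [abs_of_nonneg (pow_nonneg (radius_mem _).1 _),
        abs_of_nonneg (pow_nonneg (radius_mem _).1 _)]
  simp_rw [heq]
  have hlim : Tendsto (fun n : ℕ × ℕ => ∑' k, (‖a k‖ * |radius n.1 ^ k - radius n.2 ^ k|) ^ 2)
      atTop (𝓝 (∑' _ : ℕ, (0 : ℝ))) := by
    refine tendsto_tsum_of_dominated_convergence ha (fun k => ?_)
      (Eventually.of_forall fun n k => ?_)
    · rw [← prod_atTop_atTop_eq]
      have h1 := (tendsto_radius.comp tendsto_fst).pow k (l := atTop ×ˢ (atTop : Filter ℕ))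
      have h2 := (tendsto_radius.comp tendsto_snd).pow k (l := (atTop : Filter ℕ) ×ˢ atTop)
      have := (((h1.sub h2).abs).const_mul ‖a k‖).pow 2
      simpa using this
    · have h1 : |radius n.1 ^ k - radius n.2 ^ k| ≤ 1 := by
        have := pow_nonneg (radius_mem n.1).1 k
        have := pow_nonneg (radius_mem n.2).1 k
        have := pow_le_one₀ (n := k) (radius_mem n.1).1 (radius_mem n.1).2.le
        have := pow_le_one₀ (n := k) (radius_mem n.2).1 (radius_mem n.2).2.le
        rw [abs_le]; constructor <;> linarith
      rw [Real.norm_of_nonneg (sq_nonneg _)]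
      gcongr
      nlinarith [norm_nonneg (a k)]
  rw [tsum_zero] at hlim
  have := ((hlim.const_mul (2 * Real.pi)).sqrt)
  simpa [Function.comp_def] using (ENNReal.continuous_ofReal.tendsto _).comp this

/-- The boundary function of an `H¹` function: the functions `t ↦ g (r e^{it})` converge in `L¹`
as `r → 1` along the sequence `radius`. -/
theorem exists_boundary_function {g : ℂ → ℂ} (hg : DifferentiableOn ℂ g (Metric.ball 0 1))
    {C : ℝ} (hC : ∀ r ∈ Ico (0 : ℝ) 1, ∫ t, ‖g (circleMap 0 r t)‖ ∂circleVolume ≤ C) :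
    ∃ F : ℝ → ℂ, MemLp F 1 circleVolume ∧ Tendsto (fun n =>
      eLpNorm (fun t => g (circleMap 0 (radius n) t) - F t) 1 circleVolume) atTop (𝓝 0) := by
  obtain ⟨a, b, ha, hb, hab⟩ := exists_sq_summable_factorization hg hC
  set A : ℕ → ℝ → ℂ := fun n t => powerSum a (circleMap 0 (radius n) t) with hA
  set B : ℕ → ℝ → ℂ := fun n t => powerSum b (circleMap 0 (radius n) t) with hB
  have hAc : ∀ n, Continuous (A n) := fun n => continuous_powerSum_circleMap ha (radius_mem n)
  have hBc : ∀ n, Continuous (B n) := fun n => continuous_powerSum_circleMap hb (radius_mem n)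
  set f : ℕ → ℝ → ℂ := fun n t => g (circleMap 0 (radius n) t) with hf
  have hfAB : ∀ n t, f n t = A n t * B n t := by
    intro n t
    have hz := circleMap_mem_ball (radius_mem n) t
    have hsn : ∀ {c : ℕ → ℂ}, (Summable fun k => ‖c k‖ ^ 2) →
        Summable fun k => ‖c k * circleMap 0 (radius n) t ^ k‖ := fun hc => by
      simpa [norm_mul, norm_pow, norm_circleMap_zero, abs_of_nonneg (radius_mem n).1] using
        summable_norm_mul_pow_of_sq hc (radius_mem n)
    have := tsum_mul_tsum_eq_tsum_sum_antidiagonal_of_summable_norm (hsn ha) (hsn hb)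
    simp only [hA, hB, powerSum, hf]
    rw [this, ← (hasSum_taylorCoeff hg (mem_ball_zero_iff.1 hz)).tsum_eq]
    refine tsum_congr fun k => ?_
    rw [hab, Finset.sum_mul]
    refine Finset.sum_congr rfl fun ij hij => ?_
    rw [← Finset.HasAntidiagonal.mem_antidiagonal.1 hij, pow_add]
    ring
  have hfc : ∀ n, Continuous (f n) := fun n => continuous_comp_circleMap hg (radius_mem n)
  have hfm : ∀ n, MemLp (f n) 1 circleVolume := fun n =>
    memLp_one_iff_integrable.2 (integrable_circleVolume (hfc n))
  set MA := ENNReal.ofReal √(2 * Real.pi * ∑' k, ‖a k‖ ^ 2)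
  set MB := ENNReal.ofReal √(2 * Real.pi * ∑' k, ‖b k‖ ^ 2)
  have hbound : ∀ n : ℕ × ℕ, eLpNorm (f n.1 - f n.2) 1 circleVolume
      ≤ MA * eLpNorm (B n.1 - B n.2) 2 circleVolume
        + eLpNorm (A n.1 - A n.2) 2 circleVolume * MB := by
    intro n
    have e : f n.1 - f n.2 = A n.1 • (B n.1 - B n.2) + (A n.1 - A n.2) • B n.2 := by
      ext t
      simp only [Pi.sub_apply, Pi.add_apply, Pi.mul_apply, smul_eq_mul, hfAB]
      ring
    rw [e]
    refine (eLpNorm_add_le ?_ ?_ le_rfl).trans (add_le_add ?_ ?_)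
    · exact ((hAc _).smul ((hBc _).sub (hBc _))).aestronglyMeasurable
    · exact (((hAc _).sub (hAc _)).smul (hBc _)).aestronglyMeasurable
    · refine (eLpNorm_smul_le_mul_eLpNorm (p := 2) (q := 2)
        ((hBc _).sub (hBc _)).aestronglyMeasurable (hAc _).aestronglyMeasurable).trans ?_
      gcongr
      exact eLpNorm_two_powerSum ha (radius_mem _)
    · refine (eLpNorm_smul_le_mul_eLpNorm (p := 2) (q := 2)
        (hBc _).aestronglyMeasurable ((hAc _).sub (hAc _)).aestronglyMeasurable).trans ?_
      gcongr
      exact eLpNorm_two_powerSum hb (radius_mem _)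
  have hlim : Tendsto (fun n : ℕ × ℕ => eLpNorm (f n.1 - f n.2) 1 circleVolume) atTop (𝓝 0) := by
    refine tendsto_of_tendsto_of_tendsto_of_le_of_le tendsto_const_nhds ?_
      (fun _ => zero_le) hbound
    have h1 := ENNReal.Tendsto.const_mul (a := MA) (tendsto_eLpNorm_two_powerSum_sub hb)
      (Or.inr ENNReal.ofReal_ne_top)
    have h2 := ENNReal.Tendsto.mul_const (b := MB) (tendsto_eLpNorm_two_powerSum_sub ha)
      (Or.inr ENNReal.ofReal_ne_top)
    have h3 := h1.add h2
    rw [mul_zero, zero_mul, add_zero] at h3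
    exact h3
  have hcau : CauchySeq fun n => (hfm n).toLp (f n) := by
    rw [Lp.cauchySeq_Lp_iff_cauchySeq_eLpNorm]
    refine hlim.congr fun n => eLpNorm_congr_ae ?_
    exact ((hfm n.1).coeFn_toLp.sub (hfm n.2).coeFn_toLp).symm
  obtain ⟨F, hF⟩ := cauchySeq_tendsto_of_complete hcau
  refine ⟨F, Lp.memLp F, ?_⟩
  rw [Lp.tendsto_Lp_iff_tendsto_eLpNorm'] at hF
  refine hF.congr fun n => eLpNorm_congr_ae ?_
  filter_upwards [(hfm n).coeFn_toLp] with t ht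
  rw [Pi.sub_apply, ht]

end Boundary

/-! ### Uniqueness from boundary values on a set of positive measure -/

section Uniqueness

/-- By Jensen's formula the means of `log |g|` over circles stay bounded below as the radius tends
to `1`. -/
lemma exists_le_circleAverage_log_norm {g : ℂ → ℂ}
    (hg : DifferentiableOn ℂ g (Metric.ball 0 1)) :
    ∃ K : ℝ, ∀ R ∈ Ico (1 / 2 : ℝ) 1, K ≤ Real.circleAverage (fun z => Real.log ‖g z‖) 0 R := by
  refine ⟨((meromorphicOrderAt g 0).untop₀ : ℝ) * Real.log (1 / 2)
    + Real.log ‖meromorphicTrailingCoeffAt g 0‖, fun R hR => ?_⟩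
  have hR0 : 0 < R := by linarith [hR.1]
  have han : AnalyticOnNhd ℂ g (Metric.closedBall 0 |R|) :=
    (hg.analyticOnNhd Metric.isOpen_ball).mono
      (Metric.closedBall_subset_ball (by rw [abs_of_pos hR0]; exact hR.2))
  have hmem : (0 : ℂ) ∈ Metric.closedBall (0 : ℂ) |R| := by simp
  have hd0 := MeromorphicOn.divisor_apply han.meromorphicOn hmem
  have hnn : ∀ u, (0 : ℤ) ≤ MeromorphicOn.divisor g (Metric.closedBall 0 |R|) u :=
    fun u => MeromorphicOn.AnalyticOnNhd.divisor_nonneg han u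
  rw [MeromorphicOn.circleAverage_log_norm hR0.ne' han.meromorphicOn, ← hd0]
  have h1 : 0 ≤ ∑ᶠ u, (MeromorphicOn.divisor g (Metric.closedBall 0 |R|) u : ℝ)
      * Real.log (R * ‖0 - u‖⁻¹) := by
    refine finsum_nonneg fun u => ?_
    by_cases hu : u ∈ Metric.closedBall (0 : ℂ) |R|
    · refine mul_nonneg (mod_cast hnn u) ?_
      rcases eq_or_ne u 0 with rfl | hu0
      · simp
      · refine Real.log_nonneg ?_
        have hpos : 0 < ‖u‖ := norm_pos_iff.2 hu0
        rw [zero_sub, norm_neg, ← div_eq_mul_inv, one_le_div hpos]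
        simpa [abs_of_pos hR0] using hu
    · simp [hu]
  have h2 : (MeromorphicOn.divisor g (Metric.closedBall 0 |R|) 0 : ℝ) * Real.log (1 / 2)
      ≤ (MeromorphicOn.divisor g (Metric.closedBall 0 |R|) 0 : ℝ) * Real.log R :=
    mul_le_mul_of_nonneg_left (Real.log_le_log (by norm_num) hR.1) (mod_cast hnn 0)
  linarith

lemma ae_circleMap_ne_zero {g : ℂ → ℂ} (hg : DifferentiableOn ℂ g (Metric.ball 0 1)) {z : ℂ}
    (hz : z ∈ Metric.ball (0 : ℂ) 1) (hgz : g z ≠ 0) {R : ℝ} (hR : R ∈ Ioo (0 : ℝ) 1) :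
    ∀ᵐ t ∂circleVolume, g (circleMap 0 R t) ≠ 0 := by
  have h := (hg.analyticOnNhd Metric.isOpen_ball).preimage_zero_mem_codiscreteWithin hgz hz
    ((convex_ball _ _).isConnected ⟨z, hz⟩)
  have hsub : Metric.sphere (0 : ℂ) |R| ⊆ Metric.ball 0 1 :=
    Metric.sphere_subset_ball (by rw [abs_of_pos hR.1]; exact hR.2)
  have h2 := circleMap_preimage_codiscrete hR.1.ne' (codiscreteWithin_mono hsub h)
  exact ae_restrict_le_codiscreteWithin measurableSet_Icc
    (codiscreteWithin_mono (subset_univ _) h2)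

/-- An `H¹` function whose boundary values vanish on a set of positive measure is zero: otherwise
the integrals of `log |g|` over circles would tend to `-∞`, contradicting Jensen's formula. -/
theorem eq_zero_of_tendsto_setIntegral_zero {g : ℂ → ℂ}
    (hg : DifferentiableOn ℂ g (Metric.ball 0 1)) {C : ℝ}
    (hC : ∀ r ∈ Ico (0 : ℝ) 1, ∫ t, ‖g (circleMap 0 r t)‖ ∂circleVolume ≤ C)
    {S : Set ℝ} (hS : MeasurableSet S) (hS0 : circleVolume S ≠ 0)
    (hlim : Tendsto (fun n => ∫ t in S, ‖g (circleMap 0 (radius n) t)‖ ∂circleVolume) atTop (𝓝 0))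
    {z : ℂ} (hz : z ∈ Metric.ball (0 : ℂ) 1) : g z = 0 := by
  by_contra hgz
  obtain ⟨K, hK⟩ := exists_le_circleAverage_log_norm hg
  set σ := circleVolume.real S with hσ
  have hσ0 : 0 < σ := lt_of_le_of_ne measureReal_nonneg ((measureReal_ne_zero_iff).2 hS0).symm
  have hpi := Real.pi_pos
  -- The tangent line of the logarithm at a small `c` bounds `log |g|` on `S`.
  -- This `c` makes the total at most `2 π K - 1`.
  set c := Real.exp ((2 * Real.pi * K - C - 2) / σ + 1) with hc
  have hc0 : 0 < c := Real.exp_pos _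
  have hlogc : σ * (Real.log c - 1) = 2 * Real.pi * K - C - 2 := by
    rw [hc, Real.log_exp]; field_simp; ring
  have hev : ∀ᶠ n in atTop, ∫ t in S, ‖g (circleMap 0 (radius n) t)‖ ∂circleVolume < c ∧
      1 / 2 < radius n :=
    (hlim.eventually (Iio_mem_nhds hc0)).and
      (tendsto_radius.eventually (Ioi_mem_nhds (by norm_num)))
  obtain ⟨n, hn1, hn2⟩ := hev.exists
  set R := radius n with hR
  have hRm : R ∈ Ico (0 : ℝ) 1 := radius_mem n
  set u : ℝ → ℝ := fun t => ‖g (circleMap 0 R t)‖ with hu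
  have hui : Integrable u circleVolume :=
    integrable_circleVolume (continuous_comp_circleMap hg hRm).norm
  have hne := ae_circleMap_ne_zero hg hz hgz (R := R) ⟨by linarith, hRm.2⟩
  have hlogi : Integrable (fun t => Real.log (u t)) circleVolume := by
    have han : AnalyticOnNhd ℂ g (Metric.sphere 0 |R|) :=
      (hg.analyticOnNhd Metric.isOpen_ball).mono
        (Metric.sphere_subset_ball (by rw [abs_of_nonneg hRm.1]; exact hRm.2))
    have := han.meromorphicOn.circleIntegrable_log_norm
    rw [CircleIntegrable, intervalIntegrable_iff_integrableOn_Icc_of_le (by positivity)] at this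
    exact this
  have hKR := hK R ⟨hn2.le, hRm.2⟩
  rw [circleAverage_eq_integral, smul_eq_mul] at hKR
  have hKR' : 2 * Real.pi * K ≤ ∫ t, Real.log (u t) ∂circleVolume := by
    rw [inv_mul_eq_div, le_div_iff₀ (by positivity)] at hKR
    linarith
  have hsplit := integral_add_compl hS hlogi
  have h1 : ∫ t in S, Real.log (u t) ∂circleVolume ≤ 1 + σ * (Real.log c - 1) := by
    have hci : Integrable (fun _ : ℝ => Real.log c - 1) (circleVolume.restrict S) :=
      integrable_const _
    calc _ ≤ ∫ t in S, (u t / c + (Real.log c - 1)) ∂circleVolume := by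
          refine integral_mono_ae hlogi.restrict ((hui.restrict.div_const c).add hci) ?_
          filter_upwards [ae_restrict_of_ae hne] with t ht
          have hpos : 0 < u t := norm_pos_iff.2 ht
          have := Real.log_le_sub_one_of_pos (div_pos hpos hc0)
          rw [Real.log_div hpos.ne' hc0.ne'] at this
          linarith
      _ = (∫ t in S, u t ∂circleVolume) / c + σ * (Real.log c - 1) := by
          rw [integral_add (hui.restrict.div_const c) hci, integral_div, setIntegral_const,
            smul_eq_mul]
      _ ≤ _ := by
          gcongr
          exact (div_le_one hc0).2 hn1.le
  have h2 : ∫ t in Sᶜ, Real.log (u t) ∂circleVolume ≤ C := by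
    calc _ ≤ ∫ t in Sᶜ, u t ∂circleVolume :=
          integral_mono hlogi.restrict hui.restrict fun t => Real.log_le_self (norm_nonneg _)
      _ ≤ ∫ t, u t ∂circleVolume := setIntegral_le_integral hui (ae_of_all _ fun t => norm_nonneg _)
      _ ≤ C := hC R hRm
  linarith

end Uniqueness

/-! ### The norm of the Hardy–Lorentz space on the boundary -/

section HardyLorentzSpace

lemma slice_eq (f : Disc → ℂ) (r : ℝ) : slice f r = fun t => extend f (circleMap 0 r t) := by
  ext t; rw [slice, circleMap_zero]

lemma extend_coe (f : Disc → ℂ) (z : Disc) : extend f z = f z := by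
  rw [extend, dif_pos z.2]

lemma lorentzNorm_slice (φ : LorentzWeight (2 * Real.pi)) {f : Disc → ℂ} (hf : IsAnalytic f)
    {r : ℝ} (hr : r ∈ Ico (0 : ℝ) 1) :
    lorentzNorm φ (slice f r) = choquet φ circleVolume fun t => ‖extend f (circleMap 0 r t)‖ := by
  have hc := (continuous_comp_circleMap hf hr).norm
  obtain ⟨M, hM⟩ := (isCompact_Icc (a := (0 : ℝ)) (b := 2 * Real.pi)).bddAbove_image hc.continuousOn
  rw [slice_eq]
  exact lorentzNorm_eq_choquet φ fun s hs => hM (mem_image_of_mem _ hs)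

lemma choquet_slice_le (φ : LorentzWeight (2 * Real.pi)) {f : Disc → ℂ} (hf : IsAnalytic f)
    {r : ℝ} (hr : r ∈ Ico (0 : ℝ) 1) :
    choquet φ circleVolume (fun t => ‖extend f (circleMap 0 r t)‖)
      ≤ hardyNorm (lorentzNorm φ) f := by
  rw [← lorentzNorm_slice φ hf hr]
  exact le_iSup₂ (f := fun r (_ : r ∈ Ico (0 : ℝ) 1) => lorentzNorm φ (slice f r)) r hr

lemma integral_norm_slice_le (φ : LorentzWeight (2 * Real.pi)) {f : Disc → ℂ}
    (hf : MemHardy (lorentzNorm φ) f) {r : ℝ} (hr : r ∈ Ico (0 : ℝ) 1) :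
    ∫ t, ‖extend f (circleMap 0 r t)‖ ∂circleVolume
      ≤ 2 * Real.pi * (hardyNorm (lorentzNorm φ) f).toReal := by
  have hc := (continuous_comp_circleMap hf.1 hr).norm
  have h := (lintegral_le_choquet φ circleVolume_real_univ_le hc.measurable.aemeasurable
    (ae_of_all _ fun t => norm_nonneg _)).trans
    (mul_le_mul_right (choquet_slice_le φ hf.1 hr) _)
  rw [integral_eq_lintegral_of_nonneg_ae (ae_of_all _ fun t => norm_nonneg _)
    hc.aestronglyMeasurable]
  refine (ENNReal.toReal_mono (ENNReal.mul_ne_top ENNReal.ofReal_ne_top hf.2.ne) h).trans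
    (le_of_eq ?_)
  rw [ENNReal.toReal_mul, ENNReal.toReal_ofReal (by positivity)]

/-- `F` is the boundary function of `g`: the limit in `L¹` of `t ↦ g (r e^{it})` as `r → 1` along
the sequence `radius`. -/
def IsBoundaryFunction (g : ℂ → ℂ) (F : ℝ → ℂ) : Prop :=
  MemLp F 1 circleVolume ∧ Tendsto (fun n =>
    eLpNorm (fun t => g (circleMap 0 (radius n) t) - F t) 1 circleVolume) atTop (𝓝 0)

lemma exists_isBoundaryFunction (φ : LorentzWeight (2 * Real.pi)) {f : Disc → ℂ}
    (hf : MemHardy (lorentzNorm φ) f) : ∃ F, IsBoundaryFunction (extend f) F :=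
  exists_boundary_function hf.1 fun _ hr => integral_norm_slice_le φ hf hr

lemma aestronglyMeasurable_circleMap_sub {g : ℂ → ℂ} {F : ℝ → ℂ}
    (hg : DifferentiableOn ℂ g (Metric.ball 0 1)) (hF : MemLp F 1 circleVolume) (n : ℕ) :
    AEStronglyMeasurable (fun t => g (circleMap 0 (radius n) t) - F t) circleVolume :=
  (continuous_comp_circleMap hg (radius_mem n)).aestronglyMeasurable.sub hF.1

lemma IsBoundaryFunction.linear_combination {g h : ℂ → ℂ} {G H : ℝ → ℂ}
    (hg : DifferentiableOn ℂ g (Metric.ball 0 1)) (hh : DifferentiableOn ℂ h (Metric.ball 0 1))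
    (hG : IsBoundaryFunction g G) (hH : IsBoundaryFunction h H) (a b : ℂ) :
    IsBoundaryFunction (fun z => a * g z + b * h z) (fun t => a * G t + b * H t) := by
  refine ⟨(hG.1.const_mul a).add (hH.1.const_mul b), ?_⟩
  have h1 := (ENNReal.Tendsto.const_mul (a := ‖a‖ₑ) hG.2 (Or.inr enorm_ne_top)).add
    (ENNReal.Tendsto.const_mul (a := ‖b‖ₑ) hH.2 (Or.inr enorm_ne_top))
  rw [mul_zero, mul_zero, add_zero] at h1
  refine tendsto_of_tendsto_of_tendsto_of_le_of_le tendsto_const_nhds h1 (fun _ => zero_le)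
    fun n => ?_
  have e : (fun t => a * g (circleMap 0 (radius n) t) + b * h (circleMap 0 (radius n) t)
      - (a * G t + b * H t)) = (a • fun t => g (circleMap 0 (radius n) t) - G t)
      + (b • fun t => h (circleMap 0 (radius n) t) - H t) := by
    ext t
    simp only [Pi.add_apply, Pi.smul_apply, smul_eq_mul]
    ring
  simp only [e]
  refine (eLpNorm_add_le ((aestronglyMeasurable_circleMap_sub hg hG.1 n).const_smul a)
    ((aestronglyMeasurable_circleMap_sub hh hH.1 n).const_smul b) le_rfl).trans ?_
  rw [eLpNorm_const_smul, eLpNorm_const_smul]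

lemma lintegral_abs_norm_sub_le (u v : ℝ → ℂ) :
    ∫⁻ t, ENNReal.ofReal |‖u t‖ - ‖v t‖| ∂circleVolume
      ≤ eLpNorm (fun t => u t - v t) 1 circleVolume := by
  rw [eLpNorm_one_eq_lintegral_enorm]
  refine lintegral_mono fun t => ?_
  rw [← ofReal_norm]
  exact ENNReal.ofReal_le_ofReal (abs_norm_sub_norm_le _ _)

/-- The norm of a function of the Hardy–Lorentz space is the Lorentz norm of its boundary
function. -/
theorem choquet_boundaryFunction (φ : LorentzWeight (2 * Real.pi)) {f : Disc → ℂ}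
    (hf : IsAnalytic f) {F : ℝ → ℂ} (hF : IsBoundaryFunction (extend f) F) :
    choquet φ circleVolume (fun t => ‖F t‖) = hardyNorm (lorentzNorm φ) f := by
  set u : ℝ → ℝ → ℝ := fun r t => ‖extend f (circleMap 0 r t)‖ with hu
  have hum : ∀ r ∈ Ico (0 : ℝ) 1, AEMeasurable (u r) circleVolume := fun r hr =>
    (continuous_comp_circleMap hf hr).norm.measurable.aemeasurable
  have hFm : AEMeasurable (fun t => ‖F t‖) circleVolume := hF.1.1.norm.aemeasurable
  set ε : ℕ → ℝ≥0∞ := fun n =>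
    eLpNorm (fun t => extend f (circleMap 0 (radius n) t) - F t) 1 circleVolume with hε
  apply le_antisymm
  · refine choquet_le_of_kFunctional_le_liminf φ circleVolume_real_univ_le
      (v := fun n => u (radius n)) (fun s => ?_) fun n => choquet_slice_le φ hf (radius_mem n)
    have h1 : ∀ n, kFunctional circleVolume s (fun t => ‖F t‖) - ε n
        ≤ kFunctional circleVolume s (u (radius n)) := fun n => by
      rw [tsub_le_iff_right]
      refine (kFunctional_le_add_lintegral hFm (hum _ (radius_mem n))).trans ?_
      gcongr
      refine le_trans (le_of_eq (lintegral_congr fun t => ?_))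
        (lintegral_abs_norm_sub_le (fun t => extend f (circleMap 0 (radius n) t)) F)
      rw [abs_sub_comm]
    have h2 : Tendsto (fun n => kFunctional circleVolume s (fun t => ‖F t‖) - ε n) atTop
        (𝓝 (kFunctional circleVolume s (fun t => ‖F t‖) - 0)) :=
      ENNReal.Tendsto.sub tendsto_const_nhds hF.2 (Or.inr ENNReal.zero_ne_top)
    rw [tsub_zero] at h2
    rw [← h2.liminf_eq]
    exact liminf_le_liminf (Eventually.of_forall h1)
  · refine iSup₂_le fun r hr => ?_
    rw [lorentzNorm_slice φ hf hr]
    refine choquet_mono_of_kFunctional_le φ circleVolume_real_univ_le fun s => ?_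
    have h2 : Tendsto (fun n => kFunctional circleVolume s (fun t => ‖F t‖) + ε n) atTop
        (𝓝 (kFunctional circleVolume s (fun t => ‖F t‖) + 0)) :=
      tendsto_const_nhds.add hF.2
    rw [add_zero] at h2
    refine ge_of_tendsto h2 ?_
    filter_upwards [tendsto_radius.eventually (Ioi_mem_nhds hr.2)] with n hn
    have hcl : DiffContOnCl ℂ (extend f) (Metric.ball 0 (radius n)) :=
      DifferentiableOn.diffContOnCl (hf.mono (by
        rw [closure_ball _ (hr.1.trans_lt hn).ne']
        exact Metric.closedBall_subset_ball (radius_mem n).2))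
    refine (kFunctional_circleMap_mono hr.1 hn hcl s).trans ?_
    refine (kFunctional_le_add_lintegral (hum _ (radius_mem n)) hFm).trans ?_
    gcongr
    exact lintegral_abs_norm_sub_le (fun t => extend f (circleMap 0 (radius n) t)) F

lemma HasNontangentialLimit.tendsto_radius {f : Disc → ℂ} {t : ℝ} {w : ℂ}
    (h : HasNontangentialLimit f t w) :
    Tendsto (fun n => extend f (circleMap 0 (radius n) t)) atTop (𝓝 w) := by
  refine (h 2).comp (tendsto_nhdsWithin_iff.2 ⟨?_, Eventually.of_forall fun n => ?_⟩)
  · have h1 : Tendsto (fun n => (radius n : ℂ) * Complex.exp (t * Complex.I)) atTop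
        (𝓝 (((1 : ℝ) : ℂ) * Complex.exp (t * Complex.I))) :=
      ((Complex.continuous_ofReal.tendsto 1).comp HardyLorentz.tendsto_radius).mul_const _
    simpa [circleMap_zero] using h1
  · have hm := radius_mem n
    have hn : ‖circleMap 0 (radius n) t‖ = radius n := by
      rw [norm_circleMap_zero, abs_of_nonneg hm.1]
    have e : circleMap 0 (radius n) t - Complex.exp (t * Complex.I)
        = -((1 - radius n : ℝ) : ℂ) * Complex.exp (t * Complex.I) := by
      rw [circleMap_zero]; push_cast; ring
    refine ⟨by rw [hn]; exact hm.2, ?_⟩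
    have hpos : 0 < 1 - radius n := by linarith [hm.2]
    rw [e, hn, norm_mul, Complex.norm_exp_ofReal_mul_I, norm_neg, Complex.norm_real,
      Real.norm_of_nonneg hpos.le]
    linarith

/-- The boundary function agrees almost everywhere with the nontangential limit, wherever the latter
exists. -/
lemma IsBoundaryFunction.ae_eq_nontangentialLimit {f : Disc → ℂ} (hf : IsAnalytic f) {F : ℝ → ℂ}
    (hF : IsBoundaryFunction (extend f) F) :
    ∀ᵐ t ∂circleVolume, ∀ w, HasNontangentialLimit f t w → F t = w := by
  have hmeas : TendstoInMeasure circleVolume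
      (fun n t => extend f (circleMap 0 (radius n) t)) atTop F :=
    tendstoInMeasure_of_tendsto_eLpNorm one_ne_zero
      (fun n => (continuous_comp_circleMap hf (radius_mem n)).aestronglyMeasurable) hF.1.1 hF.2
  obtain ⟨ns, hns, hlim⟩ := hmeas.exists_seq_tendsto_ae
  filter_upwards [hlim] with t ht w hw
  exact tendsto_nhds_unique ht (hw.tendsto_radius.comp hns.tendsto_atTop)

/-- Hardy–Lorentz functions are determined by their boundary values on any set of positive
measure. -/
lemma eq_smul_of_boundaryFunction_eq (φ : LorentzWeight (2 * Real.pi)) {f g : Disc → ℂ}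
    (hf : MemHardy (lorentzNorm φ) f) (hg : MemHardy (lorentzNorm φ) g) {F G : ℝ → ℂ}
    (hF : IsBoundaryFunction (extend f) F) (hG : IsBoundaryFunction (extend g) G)
    {S : Set ℝ} (hS : MeasurableSet S) (hS0 : circleVolume S ≠ 0) {c : ℂ}
    (h : ∀ᵐ t ∂(circleVolume.restrict S), G t = c * F t) {z : ℂ}
    (hz : z ∈ Metric.ball (0 : ℂ) 1) : extend g z = c * extend f z := by
  set D : ℂ → ℂ := fun z => 1 * extend g z + (-c) * extend f z with hD
  have hDd : DifferentiableOn ℂ D (Metric.ball 0 1) := (hg.1.const_mul 1).add (hf.1.const_mul (-c))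
  have hDb := hG.linear_combination hg.1 hf.1 hF 1 (-c)
  have hDC : ∀ r ∈ Ico (0 : ℝ) 1, ∫ t, ‖D (circleMap 0 r t)‖ ∂circleVolume
      ≤ 2 * Real.pi * (hardyNorm (lorentzNorm φ) g).toReal
        + ‖c‖ * (2 * Real.pi * (hardyNorm (lorentzNorm φ) f).toReal) := by
    intro r hr
    have h1 := integrable_circleVolume (continuous_comp_circleMap hg.1 hr).norm
    have h2 := integrable_circleVolume (continuous_comp_circleMap hf.1 hr).norm
    calc _ ≤ ∫ t, (‖extend g (circleMap 0 r t)‖ + ‖c‖ * ‖extend f (circleMap 0 r t)‖)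
          ∂circleVolume := by
          refine integral_mono (integrable_circleVolume (continuous_comp_circleMap hDd hr).norm)
            (h1.add (h2.const_mul _)) fun t => ?_
          refine (norm_add_le _ _).trans (le_of_eq ?_)
          rw [one_mul, norm_mul, norm_neg]
      _ ≤ _ := by
          rw [integral_add h1 (h2.const_mul _), integral_const_mul]
          gcongr
          exacts [integral_norm_slice_le φ hg hr, integral_norm_slice_le φ hf hr]
  have hlim : Tendsto (fun n => ∫ t in S, ‖D (circleMap 0 (radius n) t)‖ ∂circleVolume) atTop
      (𝓝 0) := by
    have hle : ∀ n, ENNReal.ofReal (∫ t in S, ‖D (circleMap 0 (radius n) t)‖ ∂circleVolume)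
        ≤ eLpNorm (fun t => D (circleMap 0 (radius n) t) - (1 * G t + -c * F t)) 1
          circleVolume := by
      intro n
      have hi := (integrable_circleVolume (continuous_comp_circleMap hDd (radius_mem n)))
      rw [ofReal_integral_norm_eq_lintegral_enorm hi.restrict, eLpNorm_one_eq_lintegral_enorm]
      refine le_trans (lintegral_mono_ae ?_) (setLIntegral_le_lintegral S _)
      filter_upwards [h] with t ht
      rw [ht]
      simp
    have h0 := tendsto_of_tendsto_of_tendsto_of_le_of_le tendsto_const_nhds hDb.2
      (fun _ => zero_le) hle
    have h1 := (ENNReal.tendsto_toReal ENNReal.zero_ne_top).comp h0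
    rw [ENNReal.toReal_zero] at h1
    refine h1.congr fun n => ?_
    exact ENNReal.toReal_ofReal (integral_nonneg fun t => norm_nonneg _)
  have := eq_zero_of_tendsto_setIntegral_zero hDd hDC hS hS0 hlim hz
  simp only [hD] at this
  linear_combination this

lemma hardyNorm_const_mul (φ : LorentzWeight (2 * Real.pi)) {f g : Disc → ℂ} (hf : IsAnalytic f)
    {c : ℝ} (hc : 0 < c) (hg : IsAnalytic g) (h : ∀ z, extend g z = c * extend f z) :
    hardyNorm (lorentzNorm φ) g = ENNReal.ofReal c * hardyNorm (lorentzNorm φ) f := by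
  unfold hardyNorm
  simp_rw [ENNReal.mul_iSup]
  refine iSup_congr fun r => iSup_congr fun hr => ?_
  rw [lorentzNorm_slice φ hg hr, lorentzNorm_slice φ hf hr, ← choquet_const_mul φ
    circleVolume_real_univ_le (continuous_comp_circleMap hf hr).norm.measurable.aemeasurable hc]
  congr 1
  ext t
  rw [h, norm_mul, Complex.norm_real, Real.norm_of_nonneg hc.le]

lemma hardyNorm_le_of_bounded (φ : LorentzWeight (2 * Real.pi)) {f : Disc → ℂ}
    (hf : IsAnalytic f) {M : ℝ} (hM : ∀ z ∈ Metric.ball (0 : ℂ) 1, ‖extend f z‖ ≤ M) :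
    hardyNorm (lorentzNorm φ) f ≤ ENNReal.ofReal M := by
  refine iSup₂_le fun r hr => ?_
  rw [lorentzNorm_slice φ hf hr]
  exact choquet_le_of_bounded φ circleVolume_real_univ_le
    (ae_of_all _ fun t => hM _ (circleMap_mem_ball hr t))

end HardyLorentzSpace

/-! ### Extreme points of the unit ball -/

section ExtremePoints

/-- If a sum of vectors has the sum of the norms as its norm, each summand is a nonnegative multiple
of the sum. -/
lemma norm_smul_eq_of_norm_add_eq {x y : ℂ} (h : ‖x + y‖ = ‖x‖ + ‖y‖) :
    (‖x + y‖ : ℂ) * x = ‖x‖ * (x + y) := by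
  have h1 : SameRay ℝ x (x + y) := (SameRay.refl x).add_right (sameRay_iff_norm_add.2 h)
  have h2 := sameRay_iff_norm_smul_eq.1 h1
  simp only [Complex.real_smul] at h2
  exact h2.symm

lemma one_le_of_one_le_convex_combination {x y : ℝ≥0∞} {a b : ℝ} (ha : 0 < a) (hb : 0 ≤ b)
    (hab : a + b = 1) (hx : x ≤ 1) (hy : y ≤ 1)
    (h : 1 ≤ ENNReal.ofReal a * x + ENNReal.ofReal b * y) : 1 ≤ x := by
  have hx' := ne_top_of_le_ne_top ENNReal.one_ne_top hx
  have hy' := ne_top_of_le_ne_top ENNReal.one_ne_top hy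
  lift x to ℝ≥0 using hx'
  lift y to ℝ≥0 using hy'
  rw [← ENNReal.ofReal_coe_nnreal (p := x), ← ENNReal.ofReal_coe_nnreal (p := y),
    ← ENNReal.ofReal_mul ha.le, ← ENNReal.ofReal_mul hb,
    ← ENNReal.ofReal_add (by positivity) (by positivity), ENNReal.one_le_ofReal] at h
  have hy1 : (y : ℝ) ≤ 1 := by exact_mod_cast hy
  have : (1 : ℝ) ≤ x := by nlinarith
  exact_mod_cast this

lemma extend_linear_combination (a b : ℝ) (g h : Disc → ℂ) (z : ℂ) :
    extend (a • g + b • h) z = a * extend g z + b * extend h z := by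
  unfold extend
  split_ifs <;> simp

lemma setAverage_linear_combination {α : Type*} [MeasurableSpace α] {μ : Measure α} {S : Set α}
    {v w : α → ℝ} (hv : Integrable v μ) (hw : Integrable w μ) (a b : ℝ) :
    ⨍ x in S, (a * v x + b * w x) ∂μ = a * (⨍ x in S, v x ∂μ) + b * ⨍ x in S, w x ∂μ := by
  rw [setAverage_eq, setAverage_eq, setAverage_eq,
    integral_add (hv.restrict.const_mul a) (hw.restrict.const_mul b), integral_const_mul,
    integral_const_mul]
  simp only [smul_eq_mul]
  ring

/-- If the unit vector `u` of a Lorentz space is dominated by the convex combination `a v + b w`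
of elements of the unit ball, and is constant on `S`, then it equals this combination, and `v` is
constant on `S` as well: replacing `v` and `w` by their means over `S` preserves the
hypotheses, but would diminish the norm of `v`. -/
lemma ae_eq_of_le_convex_combination {a₀ : ℝ} (φ : LorentzWeight a₀)
    (hmono : StrictMonoOn φ (Icc 0 a₀)) (hconc : StrictConcaveOn ℝ (Icc 0 a₀) φ)
    {α : Type*} [MeasurableSpace α] {μ : Measure α} [IsFiniteMeasure μ] (hμ : μ.real univ ≤ a₀)
    {u v w : α → ℝ} (hu0 : ∀ x, 0 ≤ u x) (hv0 : ∀ x, 0 ≤ v x)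
    (hw0 : ∀ x, 0 ≤ w x) (hu : Integrable u μ) (hv : Integrable v μ) (hw : Integrable w μ)
    (hu1 : choquet φ μ u = 1) (hv1 : choquet φ μ v ≤ 1) (hw1 : choquet φ μ w ≤ 1)
    {a b : ℝ} (ha : 0 < a) (hb : 0 < b) (hab : a + b = 1)
    (huvw : ∀ x, u x ≤ a * v x + b * w x) {S : Set α} (hS : MeasurableSet S) (hS0 : μ S ≠ 0)
    {c : ℝ} (hc : ∀ᵐ x ∂(μ.restrict S), u x = c) :
    (∀ᵐ x ∂μ, u x = a * v x + b * w x) ∧ (∀ᵐ x ∂(μ.restrict S), v x = ⨍ x in S, v x ∂μ) ∧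
      choquet φ μ v = 1 := by
  have hsum : Integrable (fun x => a * v x + b * w x) μ := (hv.const_mul a).add (hw.const_mul b)
  have hone : ∀ {x y : ℝ≥0∞}, x ≤ 1 → y ≤ 1 → ENNReal.ofReal a * x + ENNReal.ofReal b * y ≤ 1 := by
    intro x y hx hy
    calc _ ≤ ENNReal.ofReal a * 1 + ENNReal.ofReal b * 1 := by gcongr
      _ = 1 := by rw [mul_one, mul_one, ← ENNReal.ofReal_add ha.le hb.le, hab, ENNReal.ofReal_one]
  have heq : u =ᵐ[μ] fun x => a * v x + b * w x := by
    refine ae_eq_of_le_of_choquet_le φ hmono hμ (ae_of_all _ hu0) hu.aemeasurable hsum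
      (ae_of_all _ huvw) (by rw [hu1]; exact ENNReal.one_ne_top) ?_
    rw [hu1]
    exact (choquet_le_add φ hμ ha.le hb.le hsum.aemeasurable hv.aemeasurable hw.aemeasurable
      (ae_of_all _ fun x => le_rfl)).trans (hone hv1 hw1)
  have hSr : 0 < μ.real S :=
    lt_of_le_of_ne measureReal_nonneg ((measureReal_ne_zero_iff).2 hS0).symm
  have hcavg : c = a * (⨍ x in S, v x ∂μ) + b * ⨍ x in S, w x ∂μ := by
    rw [← setAverage_linear_combination hv hw, setAverage_eq,
      integral_congr_ae (g := fun _ => c), setIntegral_const, smul_eq_mul, smul_eq_mul,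
      inv_mul_cancel_left₀ hSr.ne']
    filter_upwards [hc, ae_restrict_of_ae heq] with x h1 h2
    rw [← h2, h1]
  have hv1' := (choquet_averageOn_le φ hμ hS hS0 hv (ae_of_all _ hv0)).trans hv1
  have hw1' := (choquet_averageOn_le φ hμ hS hS0 hw (ae_of_all _ hw0)).trans hw1
  have havg : ∀ᵐ x ∂μ, u x ≤ a * averageOn μ S v x + b * averageOn μ S w x := by
    filter_upwards [(ae_restrict_iff' hS).1 hc] with x hx
    by_cases hxS : x ∈ S
    · rw [averageOn_of_mem hxS, averageOn_of_mem hxS, hx hxS, hcavg]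
    · rw [averageOn_of_notMem hxS, averageOn_of_notMem hxS]
      exact huvw x
  have h1 := choquet_le_add φ hμ ha.le hb.le hu.aemeasurable (aemeasurable_averageOn hS hv.aemeasurable)
    (aemeasurable_averageOn hS hw.aemeasurable) havg
  rw [hu1] at h1
  have h2 := one_le_of_one_le_convex_combination ha hb.le hab hv1' hw1' h1
  have hv1'' : choquet φ μ v = 1 :=
    le_antisymm hv1 (h2.trans (choquet_averageOn_le φ hμ hS hS0 hv (ae_of_all _ hv0)))
  exact ⟨heq, ae_eq_average_of_choquet_le φ hconc hμ hS hS0 hv (ae_of_all _ hv0)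
    (by rw [hv1'']; exact ENNReal.one_ne_top) (hv1.trans h2), hv1''⟩

/-- A unit vector of the Hardy–Lorentz space whose boundary modulus is constant on a set of positive
measure is an extreme point of the unit ball. -/
theorem mem_extremePoints_of_hasConstantModulus (φ : LorentzWeight (2 * Real.pi))
    (hmono : StrictMonoOn φ (Icc 0 (2 * Real.pi)))
    (hconc : StrictConcaveOn ℝ (Icc 0 (2 * Real.pi)) φ) {f : Disc → ℂ}
    (hf : MemHardy (lorentzNorm φ) f) (hf1 : hardyNorm (lorentzNorm φ) f = 1)
    (hconst : HasConstantModulusOnPositiveSet f) :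
    f ∈ (hardyUnitBall (lorentzNorm φ)).extremePoints ℝ := by
  rw [mem_extremePoints_iff_left]
  refine ⟨⟨hf, hf1.le⟩, ?_⟩
  rintro g ⟨hg, hg1⟩ h ⟨hh, hh1⟩ ⟨a, b, ha, hb, hab, rfl⟩
  set f := a • g + b • h with hfdef
  obtain ⟨c, E, hE, hEm, hE0, hEc⟩ := hconst
  have hE0' : circleVolume E ≠ 0 := by
    rw [Measure.restrict_apply hEm, inter_eq_self_of_subset_left hE]
    exact hE0.ne'
  obtain ⟨G, hG⟩ := exists_isBoundaryFunction φ hg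
  obtain ⟨H, hH⟩ := exists_isBoundaryFunction φ hh
  have hF : IsBoundaryFunction (extend f) fun t => a * G t + b * H t := by
    have := hG.linear_combination hg.1 hh.1 hH a b
    rwa [funext fun z => (extend_linear_combination a b g h z).symm] at this
  set F : ℝ → ℂ := fun t => a * G t + b * H t with hFdef
  have hFc : ∀ᵐ t ∂(circleVolume.restrict E), ‖F t‖ = c := by
    rw [ae_restrict_iff' hEm]
    filter_upwards [hF.ae_eq_nontangentialLimit hf.1] with t ht htE
    obtain ⟨w, hw, hwc⟩ := hEc t htE
    rw [ht w hw, hwc]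
  have hn : ∀ {x : ℝ} (_ : 0 < x) (y : ℂ), ‖(x : ℂ) * y‖ = x * ‖y‖ := fun hx y => by
    rw [norm_mul, Complex.norm_real, Real.norm_of_nonneg hx.le]
  obtain ⟨heq, hGc, hG1⟩ := ae_eq_of_le_convex_combination φ hmono hconc circleVolume_real_univ_le
    (u := fun t => ‖F t‖) (v := fun t => ‖G t‖) (w := fun t => ‖H t‖)
    (fun _ => norm_nonneg _) (fun _ => norm_nonneg _) (fun _ => norm_nonneg _)
    (memLp_one_iff_integrable.1 hF.1).norm (memLp_one_iff_integrable.1 hG.1).norm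
    (memLp_one_iff_integrable.1 hH.1).norm
    ((choquet_boundaryFunction φ hf.1 hF).trans hf1)
    ((choquet_boundaryFunction φ hg.1 hG).trans_le hg1)
    ((choquet_boundaryFunction φ hh.1 hH).trans_le hh1) ha hb hab
    (fun t => (norm_add_le _ _).trans (le_of_eq (by rw [hn ha, hn hb]))) hEm hE0' hFc
  set d := ⨍ t in E, ‖G t‖ ∂circleVolume with hd
  have hd0 : 0 ≤ d := by
    rw [hd, setAverage_eq, smul_eq_mul]
    exact mul_nonneg (inv_nonneg.2 measureReal_nonneg) (integral_nonneg fun _ => norm_nonneg _)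
  have hf0 : ¬ ∀ z ∈ Metric.ball (0 : ℂ) 1, extend f z = 0 := fun h0 => by
    have := hardyNorm_le_of_bounded φ hf.1 (M := 0) fun z hz => by rw [h0 z hz, norm_zero]
    rw [hf1, ENNReal.ofReal_zero] at this
    exact absurd this (by simp)
  have hg0 : ¬ ∀ z ∈ Metric.ball (0 : ℂ) 1, extend g z = 0 := fun h0 => by
    have := hardyNorm_le_of_bounded φ hg.1 (M := 0) fun z hz => by rw [h0 z hz, norm_zero]
    rw [← choquet_boundaryFunction φ hg.1 hG, hG1, ENNReal.ofReal_zero] at this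
    exact absurd this (by simp)
  have hc0 : c ≠ 0 := by
    rintro rfl
    refine hf0 fun z hz => ?_
    have := eq_smul_of_boundaryFunction_eq φ hf hf hF hF hEm hE0' (c := 0)
      (hFc.mono fun t ht => by rw [norm_eq_zero.1 ht, zero_mul]) hz
    rw [this, zero_mul]
  -- On `E` the values of `G` are the positive multiples of those of `F` by the constant `d / c`.
  have hGF : ∀ᵐ t ∂(circleVolume.restrict E), G t = ((d / c : ℝ) : ℂ) * F t := by
    filter_upwards [hFc, hGc, ae_restrict_of_ae heq] with t h1 h2 h3
    have h4 := norm_smul_eq_of_norm_add_eq (x := a * G t) (y := b * H t)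
      (by rw [hn ha, hn hb]; exact h3)
    rw [hn ha, h2] at h4
    have h5 : (c : ℂ) * (a * G t) = ((a * d : ℝ) : ℂ) * F t := by
      rw [← h4, ← h1]
    have ha' : (a : ℂ) ≠ 0 := Complex.ofReal_ne_zero.2 ha.ne'
    have hc' : (c : ℂ) ≠ 0 := Complex.ofReal_ne_zero.2 hc0
    push_cast at h5 ⊢
    rw [div_mul_eq_mul_div, eq_div_iff hc']
    apply mul_left_cancel₀ ha'
    linear_combination h5
  have hgf : ∀ z ∈ Metric.ball (0 : ℂ) 1, extend g z = ((d / c : ℝ) : ℂ) * extend f z :=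
    fun z hz => eq_smul_of_boundaryFunction_eq φ hf hg hF hG hEm hE0' hGF hz
  have hc_nonneg : 0 ≤ c := by
    have hne : (circleVolume.restrict E) ≠ 0 := by
      rwa [Ne, Measure.restrict_eq_zero]
    have : (ae (circleVolume.restrict E)).NeBot := ae_neBot.2 hne
    obtain ⟨t, ht⟩ := hFc.exists
    exact ht ▸ norm_nonneg _
  have hdc : 0 < d / c := by
    refine lt_of_le_of_ne (div_nonneg hd0 hc_nonneg) fun h0 => hg0 fun z hz => ?_
    rw [hgf z hz, ← h0]
    simp
  have hgf' : ∀ z, extend g z = ((d / c : ℝ) : ℂ) * extend f z := fun z => by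
    by_cases hz : z ∈ Metric.ball (0 : ℂ) 1
    · exact hgf z hz
    · simp only [extend, dif_neg hz, mul_zero]
  have h1 := hardyNorm_const_mul φ hf.1 hdc hg.1 hgf'
  rw [hf1, mul_one, ← choquet_boundaryFunction φ hg.1 hG, hG1, eq_comm,
    ENNReal.ofReal_eq_one] at h1
  funext z
  have := hgf' z
  rwa [h1, Complex.ofReal_one, one_mul, extend_coe, extend_coe] at this

end ExtremePoints

/-! ### A function that is neither inner nor outer -/

section Example

/-- The conformal map `z ↦ (1 + z) / (1 - z)` of the unit disc onto the right half-plane. -/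
def cayley (z : ℂ) : ℂ := (1 + z) / (1 - z)

/-- The function `z exp (-i log ((1 + z) / (1 - z)))`. Its boundary modulus is `exp (π / 2)` on the
upper and `exp (-π / 2)` on the lower half of the unit circle. -/
def stepModulus (z : ℂ) : ℂ := z * Complex.exp (-Complex.I * Complex.log (cayley z))

lemma cayley_re_im (z : ℂ) :
    (cayley z).re = (1 - Complex.normSq z) / Complex.normSq (1 - z) ∧
    (cayley z).im = 2 * z.im / Complex.normSq (1 - z) := by
  simp only [cayley, Complex.div_re, Complex.div_im, Complex.add_re, Complex.add_im,
    Complex.sub_re, Complex.sub_im, Complex.one_re, Complex.one_im, Complex.normSq_apply]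
  constructor <;> ring

lemma cayley_re_pos {z : ℂ} (hz : z ∈ Metric.ball (0 : ℂ) 1) : 0 < (cayley z).re := by
  have hz' : ‖z‖ < 1 := by simpa using hz
  rw [(cayley_re_im z).1]
  refine div_pos ?_ (Complex.normSq_pos.2 fun h => ?_)
  · rw [Complex.normSq_eq_norm_sq]; nlinarith [norm_nonneg z]
  · rw [← sub_eq_zero.1 h] at hz'; simp at hz'

lemma norm_stepModulus (z : ℂ) : ‖stepModulus z‖ = ‖z‖ * Real.exp (cayley z).arg := by
  rw [stepModulus, norm_mul, Complex.norm_exp]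
  simp [Complex.log_im]

lemma differentiableAt_stepModulus {z : ℂ} (hz : z ≠ 1) (h : cayley z ∈ Complex.slitPlane) :
    DifferentiableAt ℂ stepModulus z := by
  have h1 : (1 : ℂ) - z ≠ 0 := sub_ne_zero.2 hz.symm
  have hc : DifferentiableAt ℂ cayley z := by
    unfold cayley
    exact DifferentiableAt.div (by fun_prop) (by fun_prop) h1
  unfold stepModulus
  exact differentiableAt_id.mul ((hc.clog h).const_mul _).cexp

lemma differentiableOn_stepModulus : DifferentiableOn ℂ stepModulus (Metric.ball 0 1) :=
  fun z hz => (differentiableAt_stepModulus (by rintro rfl; simp at hz)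
    (Or.inl (cayley_re_pos hz))).differentiableWithinAt

lemma abs_arg_cayley_le {z : ℂ} (hz : z ∈ Metric.ball (0 : ℂ) 1) :
    |(cayley z).arg| ≤ Real.pi / 2 :=
  Complex.abs_arg_le_pi_div_two_iff.2 (cayley_re_pos hz).le

/-- Multiples of `stepModulus` as functions on the disc. -/
def stepFunction (c : ℝ) : Disc → ℂ := fun z => c * stepModulus z

lemma extend_stepFunction (c : ℝ) {z : ℂ} (hz : z ∈ Metric.ball (0 : ℂ) 1) :
    extend (stepFunction c) z = c * stepModulus z := by
  rw [extend, dif_pos hz]; rfl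

lemma isAnalytic_stepFunction (c : ℝ) : IsAnalytic (stepFunction c) :=
  (differentiableOn_stepModulus.const_mul (c : ℂ)).congr fun _ hz => extend_stepFunction c hz

lemma cayley_circle (t : ℝ) :
    (cayley (Complex.exp (t * Complex.I))).re = 0 ∧
    (cayley (Complex.exp (t * Complex.I))).im
      = 2 * Real.sin t / Complex.normSq (1 - Complex.exp (t * Complex.I)) := by
  have h := cayley_re_im (Complex.exp (t * Complex.I))
  rw [Complex.normSq_eq_norm_sq (Complex.exp _), Complex.norm_exp_ofReal_mul_I,
    Complex.exp_ofReal_mul_I_im] at h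
  simpa using h

lemma exp_ne_one_of_sin_ne_zero {t : ℝ} (ht : Real.sin t ≠ 0) :
    Complex.exp (t * Complex.I) ≠ 1 := fun h => by
  have := congrArg Complex.im h
  rw [Complex.exp_ofReal_mul_I_im, Complex.one_im] at this
  exact ht this

lemma hasNontangentialLimit_stepFunction (c : ℝ) {t : ℝ} (ht : Real.sin t ≠ 0) :
    HasNontangentialLimit (stepFunction c) t (c * stepModulus (Complex.exp (t * Complex.I))) := by
  have hne := exp_ne_one_of_sin_ne_zero ht
  have hpos : 0 < Complex.normSq (1 - Complex.exp (t * Complex.I)) :=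
    Complex.normSq_pos.2 (sub_ne_zero.2 hne.symm)
  have hslit : cayley (Complex.exp (t * Complex.I)) ∈ Complex.slitPlane := by
    refine Or.inr ?_
    rw [(cayley_circle t).2]
    exact div_ne_zero (mul_ne_zero two_ne_zero ht) hpos.ne'
  have hcont := ((differentiableAt_stepModulus hne hslit).continuousAt.const_mul (c : ℂ))
  intro M
  refine (hcont.tendsto.mono_left nhdsWithin_le_nhds).congr' ?_
  filter_upwards [self_mem_nhdsWithin] with z hz
  exact (extend_stepFunction c (mem_ball_zero_iff.2 hz.1)).symm

lemma norm_stepModulus_upper {t : ℝ} (ht : 0 < Real.sin t) :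
    ‖stepModulus (Complex.exp (t * Complex.I))‖ = Real.exp (Real.pi / 2) := by
  have hpos : 0 < Complex.normSq (1 - Complex.exp (t * Complex.I)) :=
    Complex.normSq_pos.2 (sub_ne_zero.2 (exp_ne_one_of_sin_ne_zero ht.ne').symm)
  have harg : (cayley (Complex.exp (t * Complex.I))).arg = Real.pi / 2 :=
    Complex.arg_eq_pi_div_two_iff.2 ⟨(cayley_circle t).1, by
      rw [(cayley_circle t).2]; positivity⟩
  rw [norm_stepModulus, Complex.norm_exp_ofReal_mul_I, harg, one_mul]

lemma norm_stepModulus_lower {t : ℝ} (ht : Real.sin t < 0) :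
    ‖stepModulus (Complex.exp (t * Complex.I))‖ = Real.exp (-(Real.pi / 2)) := by
  have hpos : 0 < Complex.normSq (1 - Complex.exp (t * Complex.I)) :=
    Complex.normSq_pos.2 (sub_ne_zero.2 (exp_ne_one_of_sin_ne_zero ht.ne).symm)
  have harg : (cayley (Complex.exp (t * Complex.I))).arg = -(Real.pi / 2) :=
    Complex.arg_eq_neg_pi_div_two_iff.2 ⟨(cayley_circle t).1, by
      rw [(cayley_circle t).2]; exact div_neg_of_neg_of_pos (by linarith) hpos⟩
  rw [norm_stepModulus, Complex.norm_exp_ofReal_mul_I, harg, one_mul]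

lemma hardyNorm_stepFunction_one (φ : LorentzWeight (2 * Real.pi)) :
    hardyNorm (lorentzNorm φ) (stepFunction 1) ≠ 0 ∧
    hardyNorm (lorentzNorm φ) (stepFunction 1) ≠ ∞ := by
  have hana := isAnalytic_stepFunction 1
  have hn : ∀ z ∈ Metric.ball (0 : ℂ) 1,
      ‖extend (stepFunction 1) z‖ = ‖z‖ * Real.exp (cayley z).arg := fun z hz => by
    rw [extend_stepFunction 1 hz, Complex.ofReal_one, one_mul, norm_stepModulus]
  have hfin : hardyNorm (lorentzNorm φ) (stepFunction 1) ≠ ∞ := by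
    refine ne_top_of_le_ne_top (ENNReal.ofReal_ne_top (r := Real.exp (Real.pi / 2)))
      (hardyNorm_le_of_bounded φ hana fun z hz => ?_)
    have hz' : ‖z‖ < 1 := by simpa using hz
    have h1 := Real.exp_le_exp.2 (abs_le.1 (abs_arg_cayley_le hz)).2
    rw [hn z hz]
    nlinarith [Real.exp_pos (cayley z).arg]
  refine ⟨fun h0 => ?_, hfin⟩
  have hr : (1 / 2 : ℝ) ∈ Ico (0 : ℝ) 1 := by constructor <;> norm_num
  have h1 := integral_norm_slice_le φ ⟨hana, hfin.lt_top⟩ hr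
  rw [h0, ENNReal.toReal_zero, mul_zero] at h1
  have h2 : ∫ _, (1 / 2 * Real.exp (-(Real.pi / 2)) : ℝ) ∂circleVolume
      ≤ ∫ t, ‖extend (stepFunction 1) (circleMap 0 (1 / 2) t)‖ ∂circleVolume := by
    refine integral_mono (integrable_const _)
      (integrable_circleVolume (continuous_comp_circleMap hana hr).norm) fun t => ?_
    have hm := circleMap_mem_ball hr t
    have := Real.exp_le_exp.2 (abs_le.1 (abs_arg_cayley_le hm)).1
    simp only [hn _ hm, norm_circleMap_zero]
    rw [abs_of_pos (by norm_num : (0 : ℝ) < 1 / 2)]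
    gcongr
  rw [integral_circleVolume, intervalIntegral.integral_const, sub_zero, smul_eq_mul] at h2
  have h3 : 0 < 2 * Real.pi * (1 / 2 * Real.exp (-(Real.pi / 2))) := by positivity
  linarith

/-- A multiple of `stepModulus` is a unit vector with a boundary modulus that is constant on two
half-circles. It is not inner, the two constants being different, and not outer, as it vanishes
at `0`. -/
theorem exists_hasConstantModulus_not_inner_not_outer (φ : LorentzWeight (2 * Real.pi)) :
    ∃ f : Disc → ℂ, MemHardy (lorentzNorm φ) f ∧ hardyNorm (lorentzNorm φ) f = 1 ∧
      HasConstantModulusOnPositiveSet f ∧ ¬ IsInner f ∧ ¬ IsOuter f := by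
  obtain ⟨hN0, hNtop⟩ := hardyNorm_stepFunction_one φ
  set N := (hardyNorm (lorentzNorm φ) (stepFunction 1)).toReal with hN
  have hNpos : 0 < N := ENNReal.toReal_pos hN0 hNtop
  set c := N⁻¹ with hc
  have hcpos : 0 < c := inv_pos.2 hNpos
  have hana := isAnalytic_stepFunction c
  have hnorm : hardyNorm (lorentzNorm φ) (stepFunction c) = 1 := by
    rw [hardyNorm_const_mul φ (isAnalytic_stepFunction 1) hcpos hana fun z => ?_,
      ← ENNReal.ofReal_toReal hNtop, ← hN, ← ENNReal.ofReal_mul hcpos.le, hc,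
      inv_mul_cancel₀ hNpos.ne', ENNReal.ofReal_one]
    by_cases hz : z ∈ Metric.ball (0 : ℂ) 1
    · rw [extend_stepFunction c hz, extend_stepFunction 1 hz, Complex.ofReal_one, one_mul]
    · simp only [extend, dif_neg hz, mul_zero]
  have hpi := Real.pi_pos
  have hcn : ∀ w : ℂ, ‖(c : ℂ) * w‖ = c * ‖w‖ := fun w => by
    rw [norm_mul, Complex.norm_real, Real.norm_of_nonneg hcpos.le]
  refine ⟨stepFunction c, ⟨hana, by rw [hnorm]; exact ENNReal.one_lt_top⟩, hnorm, ?_, ?_, ?_⟩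
  · refine ⟨c * Real.exp (Real.pi / 2), Ioo 0 Real.pi, ?_, measurableSet_Ioo, by simp [hpi],
      fun t ht => ?_⟩
    · exact fun t ht => ⟨ht.1.le, by linarith [ht.2]⟩
    · have hs := Real.sin_pos_of_mem_Ioo ht
      exact ⟨_, hasNontangentialLimit_stepFunction c hs.ne', by
        rw [hcn, norm_stepModulus_upper hs]⟩
  · rintro ⟨-, hin⟩
    have hex : ∀ {A : Set ℝ}, MeasurableSet A → A ⊆ Icc 0 (2 * Real.pi) → volume A ≠ 0 →
        ∃ t ∈ A, ∃ w, HasNontangentialLimit (stepFunction c) t w ∧ ‖w‖ = 1 := by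
      intro A hA hsub h0
      by_contra! hcon
      rw [ae_restrict_iff' measurableSet_Icc] at hin
      refine h0 (measure_mono_null (fun t ht => ?_) hin)
      intro himp
      obtain ⟨w, hw, hw1⟩ := himp (hsub ht)
      exact hcon t ht w hw hw1
    have huniq : ∀ {t : ℝ} {w : ℂ}, Real.sin t ≠ 0 → HasNontangentialLimit (stepFunction c) t w →
        w = c * stepModulus (Complex.exp (t * Complex.I)) := fun ht hw =>
      tendsto_nhds_unique hw.tendsto_radius
        (hasNontangentialLimit_stepFunction c ht).tendsto_radius
    obtain ⟨t, ht, w, hw, hw1⟩ := hex (A := Ioo 0 Real.pi) measurableSet_Ioo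
      (fun t ht => ⟨ht.1.le, by linarith [ht.2]⟩) (by simp [hpi])
    obtain ⟨t', ht', w', hw', hw1'⟩ := hex (A := Ioo Real.pi (2 * Real.pi)) measurableSet_Ioo
      (fun t ht => ⟨by linarith [ht.1], ht.2.le⟩) (by
        rw [Real.volume_Ioo, Ne, ENNReal.ofReal_eq_zero]; linarith)
    have hs := Real.sin_pos_of_mem_Ioo ht
    have hs' : Real.sin t' < 0 := by
      have := Real.sin_pos_of_mem_Ioo (x := t' - Real.pi)
        ⟨by linarith [ht'.1], by linarith [ht'.2]⟩
      rw [Real.sin_sub_pi] at this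
      linarith
    rw [huniq hs.ne' hw, hcn, norm_stepModulus_upper hs] at hw1
    rw [huniq hs'.ne hw', hcn, norm_stepModulus_lower hs'] at hw1'
    have h1 := mul_left_cancel₀ hcpos.ne' (hw1.trans hw1'.symm)
    have h2 := Real.exp_injective h1
    linarith
  · rintro ⟨-, h0, -⟩
    refine h0 ?_
    rw [extend_stepFunction c (by simp)]
    simp [stepModulus]

end Example

end HardyLorentz

end

theorem mainTheorem5 (φ : HardyLorentz.LorentzWeight (2 * Real.pi))
    (hmono : StrictMonoOn φ (Set.Icc 0 (2 * Real.pi)))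
    (hconc : StrictConcaveOn ℝ (Set.Icc 0 (2 * Real.pi)) φ) :
    (∀ f : HardyLorentz.Disc → ℂ,
      HardyLorentz.MemHardy (HardyLorentz.lorentzNorm φ) f →
      HardyLorentz.hardyNorm (HardyLorentz.lorentzNorm φ) f = 1 →
      HardyLorentz.HasConstantModulusOnPositiveSet f →
      f ∈ (HardyLorentz.hardyUnitBall (HardyLorentz.lorentzNorm φ)).extremePoints ℝ) ∧
    (∃ f : HardyLorentz.Disc → ℂ,
      HardyLorentz.MemHardy (HardyLorentz.lorentzNorm φ) f ∧
      HardyLorentz.hardyNorm (HardyLorentz.lorentzNorm φ) f = 1 ∧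
      HardyLorentz.HasConstantModulusOnPositiveSet f ∧
      ¬ HardyLorentz.IsInner f ∧ ¬ HardyLorentz.IsOuter f) :=
  ⟨fun _ hf hf1 hc => HardyLorentz.mem_extremePoints_of_hasConstantModulus φ hmono hconc hf hf1 hc,
    HardyLorentz.exists_hasConstantModulus_not_inner_not_outer φ⟩
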